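/- Let $d\ge 1$, $p>1$, and let $J:\{0,1,2,\dots\}\to[0,\infty)$ satisfy $J_0=0$, $J_1>0$ and $\sum_{m\in\mathbb{Z}^d}J_{|m|}<\infty$, where $|m|=|m_1|+\dots+|m_d|$. Suppose that $J$ is of order $\alpha\in(0,\infty]$, i.e. $\lim_{k\to\infty}k^{d+\alpha}J_k$ exists in $(0,\infty)$ if $\alpha<\infty$, and $\lim_{k\to\infty}k^{d+\beta}J_k=0$ for every $\beta\in(0,\infty)$ if $\alpha=\infty$. Put $\alpha'=\alpha/2$ if $\alpha<2$ and $\alpha'=1$ if $\alpha\ge2$. For complex-valued $u\in\ell^2(\mathbb{Z}^d)$ let $$(Lu)_n=\sum_{m\ne n}J_{|n-m|}(u_n-u_m),\qquad M[u]=\|u\|_{\ell^2}^2,\qquad H[u]=\tfrac12\langle Lu,u\rangle-\frac{\|u\|_{\ell^{p+1}}^{p+1}}{p+1},$$ and for $\nu>0$ let $I_\nu=\inf\{H[q]:q\in\ell^2(\mathbb{Z}^d),\ M[q]=\nu\}$. A ground state at mass $\nu$ is a $q\in\ell^2(\mathbb{Z}^d)$ with $M[q]=\nu$ and $H[q]=I_\nu$.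 The excitation threshold is $$\nu_0=\sup\Big\{\nu>0:\ \|q\|_{\ell^{p+1}}^{p+1}\le\tfrac{p+1}{2}\,\nu^{-\frac{p-1}{2}}\,\|q\|_{\ell^2}^{p-1}\,\langle Lq,q\rangle\ \text{ for all } q\in\ell^2(\mathbb{Z}^d)\Big\},$$ with $\nu_0=0$ if the set is empty. Then: 1. If $p\ge1+\frac{4\alpha'}{d}$, then $\nu_0>0$. 2. If $\nu>0$ and $\nu>\nu_0$, then $I_\nu<0$ and there is a ground state at mass $\nu$. 3. If $0<\nu<\nu_0$, then $I_\nu=0$ and there is no ground state at mass $\nu$. -/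

import Mathlib

open Filter Topology
open scoped ENNReal

noncomputable section

namespace NonlocalLattice

/-- The complex Hilbert space of square-summable functions on the lattice `ℤ^d`. -/
abbrev L2 (d : ℕ) : Type := lp (fun _ : Fin d → ℤ => ℂ) 2

/-- The `ℓ¹` length `|n| = |n₁| + ⋯ + |n_d|` of a lattice point. -/
def latticeNorm {d : ℕ} (n : Fin d → ℤ) : ℕ := ∑ i, (n i).natAbs

/-- The coupling operator `(L u)_n = ∑_{m ≠ n} J_{|n-m|} (u_n - u_m)`.
The term with `m = n` is zero, so the sum may run over all `m`; it converges absolutely when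
`m ↦ J_{|m|}` is summable and `u` is bounded. -/
def couplingOp {d : ℕ} (J : ℕ → ℝ) (u : (Fin d → ℤ) → ℂ) (n : Fin d → ℤ) : ℂ :=
  ∑' m : Fin d → ℤ, (J (latticeNorm (n - m)) : ℂ) * (u n - u m)

/-- The quadratic form `⟨L u, u⟩ = ∑_n (L u)_n * conj (u_n)`. The sum is real (`L` is
self-adjoint); the real part is taken only to obtain a value of type `ℝ`. -/
def quadForm {d : ℕ} (J : ℕ → ℝ) (u : L2 d) : ℝ :=
  (∑' n : Fin d → ℤ, couplingOp J u n * (starRingEnd ℂ) (u n)).re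

/-- The mass `M[u] = ‖u‖²` in `ℓ²`. -/
def mass {d : ℕ} (u : L2 d) : ℝ := ‖u‖ ^ 2

/-- The quantity `∑_n |u_n|^(p+1)`, i.e. the `(p+1)`-st power of the `ℓ^(p+1)` norm. -/
def powerSum {d : ℕ} (p : ℝ) (u : L2 d) : ℝ := ∑' n : Fin d → ℤ, ‖u n‖ ^ (p + 1)

/-- The Hamiltonian `H[u] = ⟨L u, u⟩ / 2 - ‖u‖_{p+1}^{p+1} / (p+1)`. -/
def energy {d : ℕ} (J : ℕ → ℝ) (p : ℝ) (u : L2 d) : ℝ :=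
  quadForm J u / 2 - powerSum p u / (p + 1)

/-- `I_ν`, the infimum of `H` over all `q` in `ℓ²(ℤ^d)` of mass `ν`, as an extended real. -/
def minEnergy (d : ℕ) (J : ℕ → ℝ) (p ν : ℝ) : EReal :=
  ⨅ q ∈ {q : L2 d | mass q = ν}, (energy J p q : EReal)

/-- `q` is a ground state at mass `ν`: it has mass `ν` and attains `I_ν`. -/
def IsGroundState {d : ℕ} (J : ℕ → ℝ) (p ν : ℝ) (q : L2 d) : Prop :=
  mass q = ν ∧ (energy J p q : EReal) = minEnergy d J p ν

/-- The Gagliardo-Nirenberg-type inequality at `ν`: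
`‖q‖_{p+1}^{p+1} ≤ (p+1)/2 * ν^(-(p-1)/2) * ‖q‖_2^(p-1) * ⟨L q, q⟩` for all `q` in `ℓ²(ℤ^d)`. -/
def GNInequality (d : ℕ) (J : ℕ → ℝ) (p ν : ℝ) : Prop :=
  ∀ q : L2 d, powerSum p q ≤
    (p + 1) / 2 * ν ^ (-((p - 1) / 2)) * ‖q‖ ^ (p - 1) * quadForm J q

/-- The excitation threshold `ν₀`, the supremum of the `ν > 0` at which the inequality holds,
and `0` if there are none. The set is bounded above when `1 < p` and `J` is summable over
the lattice, as one sees by testing with a Kronecker delta. -/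
def excitationThreshold (d : ℕ) (J : ℕ → ℝ) (p : ℝ) : ℝ :=
  sSup {ν : ℝ | 0 < ν ∧ GNInequality d J p ν}

/-- `J` is of order `α ∈ (0, ∞]` in dimension `d`: for `α < ∞` the limit of `k^(d+α) J_k` exists
and lies in `(0, ∞)`; for `α = ∞` the limit of `k^(d+β) J_k` is `0` for every finite `β > 0`. -/
def IsOfOrder (d : ℕ) (J : ℕ → ℝ) (α : ℝ≥0∞) : Prop :=
  0 < α ∧
  (α ≠ ⊤ → ∃ A : ℝ, 0 < A ∧
    Tendsto (fun k : ℕ => (k : ℝ) ^ ((d : ℝ) + α.toReal) * J k) atTop (𝓝 A)) ∧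
  (α = ⊤ → ∀ β : ℝ, 0 < β →
    Tendsto (fun k : ℕ => (k : ℝ) ^ ((d : ℝ) + β) * J k) atTop (𝓝 0))

/-- `α' = α / 2` for `α < 2`, and `α' = 1` for `α ≥ 2` (including `α = ∞`). -/
def alphaPrime (α : ℝ≥0∞) : ℝ := if α < 2 then α.toReal / 2 else 1

end NonlocalLattice

end

namespace NonlocalLattice

variable {d : ℕ}

/-! Everything rests on writing the quadratic form as `∑ₘ J_{|m|} ‖Tₘu - u‖² / 2` with `Tₘ` the
translations (`hasSum_quadForm`).

Above the threshold the inequality has a violator, and rescaling it to mass `ν` makes its energy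
negative. Negative energy rules out vanishing: a minimizing sequence can be translated to stay away
from zero at the origin, so it has a nonzero pointwise limit `q`. The energy splits between `q` and
the remainder up to a vanishing error, and since the nonlinear term scales faster than the quadratic
one, losing mass would be strictly unprofitable (`le_energy_of_mass_le`, `exists_minimizer`).

Below the threshold the inequality at a larger mass makes every energy positive, while the slowly
varying profiles `exp (-ε|n|)` drive it to zero.

For positivity of the threshold, averaging `‖Tₕg - g‖²` over a box of displacements twice as large
as the support of `g` gives a Faber–Krahn inequality. Applied to dyadic height layers of `|q|`, it
yields the Gagliardo–Nirenberg inequality at the critical exponent `1 + 4α'/d`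
(`powerSum_le_of_faberKrahn`); `‖q‖_∞ ≤ ‖q‖₂` then covers larger `p`. -/

theorem hasSum_norm_sq (u : L2 d) : HasSum (fun n => ‖u n‖ ^ 2) (‖u‖ ^ 2) := by
  have h := lp.hasSum_norm (p := 2) (by norm_num) u
  simpa using h

theorem norm_apply_le (u : L2 d) (n : Fin d → ℤ) : ‖u n‖ ≤ ‖u‖ :=
  lp.norm_apply_le_norm (by norm_num) u n

theorem memℓp_two_of_summable {f : (Fin d → ℤ) → ℂ} (hf : Summable fun n => ‖f n‖ ^ 2) :
    Memℓp f 2 := by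
  apply memℓp_gen
  simpa using hf

theorem hasSum_norm_sq_add (u : L2 d) (m : Fin d → ℤ) :
    HasSum (fun n => ‖u (n + m)‖ ^ 2) (‖u‖ ^ 2) :=
  (Equiv.addRight m).hasSum_iff (f := fun n => ‖u n‖ ^ 2) |>.2 (hasSum_norm_sq u)

/-- The translation `(T_m u)_n = u_{n+m}` as a linear isometry of `ℓ²(ℤ^d)`. -/
noncomputable def translation (m : Fin d → ℤ) : L2 d →ₗᵢ[ℂ] L2 d where
  toFun u := ⟨fun n => u (n + m), memℓp_two_of_summable (hasSum_norm_sq_add u m).summable⟩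
  map_add' u v := by ext n; rfl
  map_smul' c u := by ext n; rfl
  norm_map' u := by
    rw [← sq_eq_sq₀ (norm_nonneg _) (norm_nonneg _)]
    exact (hasSum_norm_sq _).unique (hasSum_norm_sq_add u m)

@[simp] theorem translation_apply (m n : Fin d → ℤ) (u : L2 d) :
    translation m u n = u (n + m) := rfl

theorem translation_add (m k : Fin d → ℤ) (u : L2 d) :
    translation (m + k) u = translation m (translation k u) := by
  ext n; simp [add_assoc]

@[simp] theorem translation_zero (u : L2 d) : translation 0 u = u := by
  ext n; simp

theorem latticeNorm_neg (n : Fin d → ℤ) : latticeNorm (-n) = latticeNorm n := by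
  simp [latticeNorm]

/-! ### The coupling operator and its quadratic form -/

/-- The contribution `J_{|m|} (1 - T_m)` of the displacement `m` to the coupling operator. -/
noncomputable def couplingTerm (J : ℕ → ℝ) (m : Fin d → ℤ) : L2 d →L[ℂ] L2 d :=
  (J (latticeNorm m) : ℂ) •
    (ContinuousLinearMap.id ℂ (L2 d) - (translation m).toContinuousLinearMap)

/-- The coupling operator as a bounded operator on `ℓ²(ℤ^d)`. -/
noncomputable def couplingCLM (d : ℕ) (J : ℕ → ℝ) : L2 d →L[ℂ] L2 d :=
  ∑' m : Fin d → ℤ, couplingTerm J m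

variable {J : ℕ → ℝ}

theorem couplingTerm_apply (m : Fin d → ℤ) (u : L2 d) :
    couplingTerm J m u = (J (latticeNorm m) : ℂ) • (u - translation m u) := rfl

theorem norm_couplingTerm_le (hJ : ∀ k, 0 ≤ J k) (m : Fin d → ℤ) :
    ‖couplingTerm (d := d) J m‖ ≤ J (latticeNorm m) * 2 := by
  refine ContinuousLinearMap.opNorm_le_bound _ (mul_nonneg (hJ _) zero_le_two) fun u => ?_
  rw [couplingTerm_apply, norm_smul, Complex.norm_real, Real.norm_of_nonneg (hJ _), mul_assoc]
  refine mul_le_mul_of_nonneg_left ?_ (hJ _)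
  refine (norm_sub_le _ _).trans ?_
  rw [(translation m).norm_map, two_mul]

theorem hasSum_couplingCLM (hs : Summable (fun m : Fin d → ℤ => J (latticeNorm m)))
    (hJ : ∀ k, 0 ≤ J k) (u : L2 d) :
    HasSum (fun m : Fin d → ℤ => (J (latticeNorm m) : ℂ) • (u - translation m u))
      (couplingCLM d J u) := by
  have h : Summable fun m : Fin d → ℤ => couplingTerm J m :=
    Summable.of_norm_bounded (hs.mul_right 2) (norm_couplingTerm_le hJ)
  exact h.hasSum.mapL (ContinuousLinearMap.apply ℂ (L2 d) u)

/-- Evaluation at a lattice point as a bounded functional. -/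
noncomputable def evalCLM (n : Fin d → ℤ) : L2 d →L[ℂ] ℂ :=
  LinearMap.mkContinuous
    { toFun := fun u => u n, map_add' := fun _ _ => rfl, map_smul' := fun _ _ => rfl } 1
    fun u => (norm_apply_le u n).trans_eq (one_mul _).symm

@[simp] theorem evalCLM_apply (n : Fin d → ℤ) (u : L2 d) : evalCLM n u = u n := rfl

theorem couplingCLM_apply (hs : Summable (fun m : Fin d → ℤ => J (latticeNorm m)))
    (hJ : ∀ k, 0 ≤ J k) (u : L2 d) (n : Fin d → ℤ) :
    couplingCLM d J u n = couplingOp J u n := by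
  have h := (evalCLM n).hasSum (hasSum_couplingCLM hs hJ u)
  have h' : HasSum (fun m : Fin d → ℤ => (J (latticeNorm (n - m)) : ℂ) * (u n - u m))
      (couplingCLM d J u n) := by
    rw [← (Equiv.addLeft n).hasSum_iff]
    refine h.congr_fun ?_
    intro m
    have : n - (n + m) = -m := by abel
    simp [this, latticeNorm_neg]
  exact h'.tsum_eq.symm

theorem quadForm_eq_inner (hs : Summable (fun m : Fin d → ℤ => J (latticeNorm m)))
    (hJ : ∀ k, 0 ≤ J k) (u : L2 d) :
    quadForm J u = (inner ℂ u (couplingCLM d J u)).re := by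
  rw [lp.inner_eq_tsum, quadForm]
  congr 2; ext n
  rw [← couplingCLM_apply hs hJ]
  simp

/-- Since `Tₘ` is an isometry, `Re ⟨u, u - Tₘu⟩ = ‖Tₘu - u‖² / 2`. -/
theorem hasSum_quadForm (hs : Summable (fun m : Fin d → ℤ => J (latticeNorm m)))
    (hJ : ∀ k, 0 ≤ J k) (u : L2 d) :
    HasSum (fun m : Fin d → ℤ => J (latticeNorm m) * (‖translation m u - u‖ ^ 2 / 2))
      (quadForm J u) := by
  rw [quadForm_eq_inner hs hJ]
  have h := Complex.reCLM.hasSum ((innerSL ℂ u).hasSum (hasSum_couplingCLM hs hJ u))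
  refine h.congr_fun ?_
  intro m
  have h1 := norm_sub_sq (𝕜 := ℂ) u (translation m u)
  rw [(translation m).norm_map] at h1
  have h2 : (inner ℂ u u).re = ‖u‖ ^ 2 := inner_self_eq_norm_sq (𝕜 := ℂ) u
  rw [norm_sub_rev, h1]
  simp only [innerSL_apply_apply, inner_smul_right, inner_sub_right, Complex.reCLM_apply,
    Complex.re_ofReal_mul, Complex.sub_re, h2, RCLike.re_eq_complex_re]
  ring

theorem quadForm_nonneg (hs : Summable (fun m : Fin d → ℤ => J (latticeNorm m)))
    (hJ : ∀ k, 0 ≤ J k) (u : L2 d) : 0 ≤ quadForm J u :=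
  (hasSum_quadForm hs hJ u).nonneg fun m => mul_nonneg (hJ _) (by positivity)

theorem mul_norm_translation_sub_sq_le
    (hs : Summable (fun m : Fin d → ℤ => J (latticeNorm m))) (hJ : ∀ k, 0 ≤ J k) (u : L2 d)
    (H : Finset (Fin d → ℤ)) :
    ∑ m ∈ H, J (latticeNorm m) * ‖translation m u - u‖ ^ 2 ≤ 2 * quadForm J u := by
  have h := sum_le_hasSum H (fun m _ => mul_nonneg (hJ _) (by positivity))
    (hasSum_quadForm hs hJ u)
  calc _ = 2 * ∑ m ∈ H, J (latticeNorm m) * (‖translation m u - u‖ ^ 2 / 2) := by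
        rw [Finset.mul_sum]; exact Finset.sum_congr rfl fun _ _ => by ring
    _ ≤ _ := by linarith

theorem latticeNorm_single (i : Fin d) : latticeNorm (Pi.single i (1 : ℤ)) = 1 := by
  rw [latticeNorm, Finset.sum_eq_single i] <;> simp +contextual

/-- If the form vanishes, the `J₁` term makes `u` invariant under a unit step, hence constant along
an infinite ray; square-summability then forces it to be zero. -/
theorem quadForm_pos (hd : 1 ≤ d) (hs : Summable (fun m : Fin d → ℤ => J (latticeNorm m)))
    (hJ : ∀ k, 0 ≤ J k) (hJ1 : 0 < J 1) {u : L2 d} (hu : u ≠ 0) : 0 < quadForm J u := by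
  refine lt_of_le_of_ne (quadForm_nonneg hs hJ u) fun h0 => hu ?_
  let e : Fin d → ℤ := Pi.single ⟨0, hd⟩ 1
  have h1 := mul_norm_translation_sub_sq_le hs hJ u {e}
  simp only [Finset.sum_singleton, ← h0, mul_zero, e, latticeNorm_single] at h1
  have h2 : ‖translation e u - u‖ = 0 := by
    by_contra h
    have : 0 < J 1 * ‖translation e u - u‖ ^ 2 := by positivity
    linarith
  have h3 : ∀ n, u (n + e) = u n := fun n => by
    have := congrArg (fun v : L2 d => v n) (sub_eq_zero.1 (norm_eq_zero.1 h2))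
    simpa using this
  have h4 : ∀ (k : ℕ) n, u (n + k • e) = u n := by
    intro k; induction k with
    | zero => simp
    | succ k ih => intro n; rw [succ_nsmul, ← add_assoc, h3, ih]
  ext n
  have hinj : Function.Injective fun k : ℕ => n + k • e := by
    intro a b hab
    have := congrFun hab ⟨0, hd⟩
    simpa [e] using this
  have h5 := (hasSum_norm_sq u).summable.tendsto_cofinite_zero.comp hinj.tendsto_cofinite
  have h6 : (fun n => ‖u n‖ ^ 2) ∘ (fun k : ℕ => n + k • e) = fun _ => ‖u n‖ ^ 2 := by
    ext k; simp only [Function.comp_apply, h4]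
  rw [h6, Nat.cofinite_eq_atTop] at h5
  have := tendsto_nhds_unique h5 tendsto_const_nhds
  simpa using this.symm

theorem quadForm_smul (hs : Summable (fun m : Fin d → ℤ => J (latticeNorm m)))
    (hJ : ∀ k, 0 ≤ J k) (c : ℝ) (u : L2 d) :
    quadForm J ((c : ℂ) • u) = c ^ 2 * quadForm J u := by
  refine (hasSum_quadForm hs hJ _).unique ?_
  refine ((hasSum_quadForm hs hJ u).mul_left (c ^ 2)).congr_fun fun m => ?_
  rw [map_smul, ← smul_sub, norm_smul, Complex.norm_real, mul_pow, Real.norm_eq_abs, sq_abs]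
  ring

/-- Only the weak continuity of the cross term matters later, so its representing vector `w` stays
anonymous. Taking `Lu + L*u` avoids proving `L` self-adjoint. -/
theorem quadForm_add (hs : Summable (fun m : Fin d → ℤ => J (latticeNorm m)))
    (hJ : ∀ k, 0 ≤ J k) (u : L2 d) :
    ∃ w : L2 d, ∀ v : L2 d,
      quadForm J (u + v) = quadForm J u + quadForm J v + (inner ℂ w v).re := by
  refine ⟨couplingCLM d J u + (couplingCLM d J).adjoint u, fun v => ?_⟩
  simp only [quadForm_eq_inner hs hJ, map_add, inner_add_left, inner_add_right,
    ContinuousLinearMap.adjoint_inner_left, Complex.add_re]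
  rw [← inner_conj_symm (couplingCLM d J u) v, Complex.conj_re]
  ring

theorem quadForm_translation (hs : Summable (fun m : Fin d → ℤ => J (latticeNorm m)))
    (hJ : ∀ k, 0 ≤ J k) (k : Fin d → ℤ) (u : L2 d) :
    quadForm J (translation k u) = quadForm J u := by
  refine (hasSum_quadForm hs hJ _).unique ?_
  refine (hasSum_quadForm hs hJ u).congr_fun fun m => ?_
  rw [← translation_add, add_comm m k, translation_add, ← map_sub, (translation k).norm_map]

/-! ### The nonlinear term -/

section PowerSum

variable {p : ℝ}

theorem norm_rpow_le (hp : 1 < p) {u : L2 d} {A : ℝ} (n : Fin d → ℤ) (hA : ‖u n‖ ≤ A) :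
    ‖u n‖ ^ (p + 1) ≤ A ^ (p - 1) * ‖u n‖ ^ 2 := by
  have : p + 1 = (p - 1) + 2 := by ring
  rw [this, Real.rpow_add_of_nonneg (norm_nonneg _) (by linarith) (by norm_num), Real.rpow_two]
  gcongr

theorem summable_powerSum (hp : 1 < p) (u : L2 d) : Summable fun n => ‖u n‖ ^ (p + 1) :=
  Summable.of_nonneg_of_le (fun _ => by positivity)
    (fun n => norm_rpow_le hp n (norm_apply_le u n)) ((hasSum_norm_sq u).summable.mul_left _)

theorem powerSum_le (hp : 1 < p) {u : L2 d} {A : ℝ} (hA : ∀ n, ‖u n‖ ≤ A) :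
    powerSum p u ≤ A ^ (p - 1) * ‖u‖ ^ 2 :=
  hasSum_le (fun n => norm_rpow_le hp n (hA n)) (summable_powerSum hp u).hasSum
    ((hasSum_norm_sq u).mul_left _)

theorem powerSum_nonneg (u : L2 d) : 0 ≤ powerSum p u := tsum_nonneg fun _ => by positivity

theorem powerSum_pos (hp : 1 < p) {u : L2 d} (hu : u ≠ 0) : 0 < powerSum p u := by
  obtain ⟨n, hn⟩ : ∃ n, u n ≠ 0 := by
    by_contra! h
    exact hu (by ext n; simpa using h n)
  exact (summable_powerSum hp u).tsum_pos (fun _ => by positivity) n (by positivity)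

theorem powerSum_smul {c : ℝ} (hc : 0 ≤ c) (u : L2 d) :
    powerSum p ((c : ℂ) • u) = c ^ (p + 1) * powerSum p u := by
  simp only [powerSum]
  rw [← tsum_mul_left]
  congr 1; ext n
  rw [lp.coeFn_smul, Pi.smul_apply, norm_smul, Complex.norm_real, Real.norm_of_nonneg hc,
    Real.mul_rpow hc (norm_nonneg _)]

theorem powerSum_translation (k : Fin d → ℤ) (u : L2 d) :
    powerSum p (translation k u) = powerSum p u :=
  (Equiv.addRight k).tsum_eq fun n => ‖u n‖ ^ (p + 1)

theorem bddAbove_gnInequality (hp : 1 < p) : BddAbove {ν : ℝ | 0 < ν ∧ GNInequality d J p ν} := by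
  let δ : L2 d := lp.single 2 0 (1 : ℂ)
  have hδ : ‖δ‖ = 1 := by simp [δ, lp.norm_single]
  have hδ0 : δ ≠ 0 := fun h => by simp [h] at hδ
  have hN : 1 ≤ powerSum p δ := by
    have h1 : ‖δ 0‖ ^ (p + 1) = 1 := by simp [δ]
    rw [← h1]
    exact (summable_powerSum hp δ).le_tsum 0 fun _ _ => by positivity
  refine ⟨((p + 1) / 2 * quadForm J δ) ^ (2 / (p - 1)), fun ν ⟨hν, h⟩ => ?_⟩
  have h1 := hN.trans (h δ)
  rw [hδ, Real.one_rpow, mul_one, Real.rpow_neg hν.le] at h1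
  have hpos : 0 < ν ^ ((p - 1) / 2) := by positivity
  have h2 : ν ^ ((p - 1) / 2) ≤ (p + 1) / 2 * quadForm J δ := by
    rw [mul_right_comm, ← div_eq_mul_inv, one_le_div hpos] at h1
    exact h1
  calc ν = (ν ^ ((p - 1) / 2)) ^ (2 / (p - 1)) := by
        rw [← Real.rpow_mul hν.le]
        have : (p - 1) / 2 * (2 / (p - 1)) = 1 := by
          have : p - 1 ≠ 0 := by linarith
          field_simp
        rw [this, Real.rpow_one]
    _ ≤ _ := Real.rpow_le_rpow hpos.le h2 (div_nonneg zero_le_two (by linarith))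

end PowerSum

/-! ### Splitting and compactness under pointwise convergence -/

variable {p : ℝ}

/-- Bernoulli's inequality for `(1 - b/(a+b))^(p+1)`, multiplied by `(a+b)^(p+1)`; then `a + b ≤ 2a`
and `a + b ≤ 2R` bound the error. -/
theorem add_rpow_le_of_le (hp : 1 < p) {R a b : ℝ} (hb : 0 ≤ b) (hba : b ≤ a) (haR : a ≤ R) :
    (a + b) ^ (p + 1) ≤ a ^ (p + 1) + 2 * (p + 1) * (2 * R) ^ (p - 1) * (a * b) := by
  rcases (add_nonneg (hb.trans hba) hb).eq_or_lt with h0 | h0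
  · have ha : a = 0 := by linarith
    have hb' : b = 0 := by linarith
    simp [ha, hb']
  have ha : 0 ≤ a := hb.trans hba
  have h1 := one_add_mul_self_le_rpow_one_add (s := -(b / (a + b))) (p := p + 1)
    (neg_le_neg ((div_le_one h0).2 (by linarith))) (by linarith)
  have h2 : 1 + -(b / (a + b)) = a / (a + b) := by field_simp; ring
  rw [h2, Real.div_rpow ha h0.le, le_div_iff₀ (by positivity)] at h1
  have h3 : (a + b) ^ (p + 1) = (a + b) ^ (p - 1) * (a + b) ^ 2 := by
    rw [← Real.rpow_two, ← Real.rpow_add h0]; congr 1; ring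
  have h4 : b / (a + b) * (a + b) ^ (p + 1) = (a + b) ^ (p - 1) * (b * (a + b)) := by
    rw [h3]; field_simp
  have h5 : (a + b) ^ (p - 1) * (b * (a + b)) ≤ (2 * R) ^ (p - 1) * (b * (2 * a)) := by
    have : (a + b) ^ (p - 1) ≤ (2 * R) ^ (p - 1) :=
      Real.rpow_le_rpow h0.le (by linarith) (by linarith)
    gcongr
    · exact Real.rpow_nonneg (by linarith) _
    · linarith
  have h6 := mul_le_mul_of_nonneg_left h5 (by linarith : 0 ≤ p + 1)
  nlinarith [h1, h4, h6]

theorem add_rpow_le (hp : 1 < p) {R a b : ℝ} (ha : 0 ≤ a) (hb : 0 ≤ b) (haR : a ≤ R)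
    (hbR : b ≤ R) :
    (a + b) ^ (p + 1) ≤
      a ^ (p + 1) + b ^ (p + 1) + 2 * (p + 1) * (2 * R) ^ (p - 1) * (a * b) := by
  rcases le_total b a with h | h
  · have := add_rpow_le_of_le hp hb h haR
    have := Real.rpow_nonneg hb (p + 1)
    linarith
  · have := add_rpow_le_of_le hp ha h hbR
    have := Real.rpow_nonneg ha (p + 1)
    rw [add_comm a b, mul_comm a b]
    linarith

theorem summable_norm_mul_norm (u v : L2 d) : Summable fun n => ‖u n‖ * ‖v n‖ := by
  refine Summable.of_nonneg_of_le (fun _ => by positivity) (fun n => ?_)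
    ((hasSum_norm_sq u).summable.add (hasSum_norm_sq v).summable)
  nlinarith [sq_nonneg (‖u n‖ - ‖v n‖), sq_nonneg (‖u n‖), sq_nonneg (‖v n‖)]

/-- A one-sided substitute for the Brezis–Lieb lemma: the error is linear in `‖u n‖ * ‖v n‖`, so it
disappears as `v` tends weakly to zero. -/
theorem powerSum_add_le (hp : 1 < p) {R : ℝ} {u v : L2 d} (hu : ‖u‖ ≤ R) (hv : ‖v‖ ≤ R) :
    powerSum p (u + v) ≤ powerSum p u + powerSum p v +
      2 * (p + 1) * (2 * R) ^ (p - 1) * ∑' n, ‖u n‖ * ‖v n‖ := by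
  refine hasSum_le (fun n => ?_) (summable_powerSum hp (u + v)).hasSum
    (((summable_powerSum hp u).hasSum.add (summable_powerSum hp v).hasSum).add
      ((summable_norm_mul_norm u v).hasSum.mul_left _))
  refine le_trans ?_ (add_rpow_le hp (norm_nonneg _) (norm_nonneg _)
    ((norm_apply_le u n).trans hu) ((norm_apply_le v n).trans hv))
  exact Real.rpow_le_rpow (norm_nonneg _) (norm_add_le _ _) (by linarith)

/-- The excess of `‖w n‖ ‖a n‖` over `δ ‖a n‖²` is at most `‖w n‖² / δ`, a summable majorant
independent of the sequence. Dominated convergence handles this excess, and the rest is at most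
`δR²`. -/
theorem tendsto_tsum_norm_mul_norm {R : ℝ} (w : L2 d) {a : ℕ → L2 d} (ha : ∀ k, ‖a k‖ ≤ R)
    (h0 : ∀ n, Tendsto (fun k => a k n) atTop (𝓝 0)) :
    Tendsto (fun k => ∑' n, ‖w n‖ * ‖a k n‖) atTop (𝓝 0) := by
  have key : ∀ δ : ℝ, 0 < δ →
      Tendsto (fun k => ∑' n, max 0 (‖w n‖ * ‖a k n‖ - δ * ‖a k n‖ ^ 2)) atTop (𝓝 0) := by
    intro δ hδ
    have hb : ∀ n k, max 0 (‖w n‖ * ‖a k n‖ - δ * ‖a k n‖ ^ 2) ≤ ‖w n‖ ^ 2 / δ := by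
      intro n k
      refine max_le (by positivity) ?_
      rw [le_div_iff₀ hδ]
      nlinarith [sq_nonneg (‖w n‖ - δ * ‖a k n‖), sq_nonneg (‖w n‖), sq_nonneg (δ * ‖a k n‖)]
    have := tendsto_tsum_of_dominated_convergence (𝓕 := atTop)
      (f := fun k n => max 0 (‖w n‖ * ‖a k n‖ - δ * ‖a k n‖ ^ 2)) (g := fun _ => (0 : ℝ))
      ((hasSum_norm_sq w).summable.div_const δ) ?_ (Eventually.of_forall fun k n => ?_)
    · simpa using this
    · intro n
      have h1 := (h0 n).norm
      have h2 := (tendsto_const_nhds (x := (0 : ℝ))).max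
        ((h1.const_mul ‖w n‖).sub ((h1.pow 2).const_mul δ))
      simpa using h2
    · rw [Real.norm_of_nonneg (le_max_left _ _)]
      exact hb n k
  have hR : 0 ≤ R := (norm_nonneg _).trans (ha 0)
  rw [Metric.tendsto_atTop]
  intro ε hε
  -- The `+ 1` keeps the denominator positive when `R = 0`.
  have hδ : 0 < ε / (2 * (R ^ 2 + 1)) := by positivity
  set δ := ε / (2 * (R ^ 2 + 1)) with hδ_def
  obtain ⟨N, hN⟩ := (Metric.tendsto_atTop.1 (key δ hδ)) (ε / 2) (by positivity)
  refine ⟨N, fun k hk => ?_⟩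
  have h1 := hN k hk
  rw [Real.dist_eq, sub_zero] at h1 ⊢
  rw [abs_of_nonneg (tsum_nonneg fun _ => by positivity)]
  have hs : Summable fun n => max 0 (‖w n‖ * ‖a k n‖ - δ * ‖a k n‖ ^ 2) := by
    refine Summable.of_nonneg_of_le (fun _ => le_max_left _ _) (fun n => ?_)
      (summable_norm_mul_norm w (a k))
    exact max_le (by positivity) (sub_le_self _ (by positivity))
  have h2 : ∑' n, ‖w n‖ * ‖a k n‖ ≤
      ∑' n, max 0 (‖w n‖ * ‖a k n‖ - δ * ‖a k n‖ ^ 2) + δ * ‖a k‖ ^ 2 := by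
    refine hasSum_le (fun n => ?_) (summable_norm_mul_norm w (a k)).hasSum
      (hs.hasSum.add ((hasSum_norm_sq (a k)).mul_left δ))
    have := le_max_right 0 (‖w n‖ * ‖a k n‖ - δ * ‖a k n‖ ^ 2)
    linarith
  have h3 : δ * ‖a k‖ ^ 2 ≤ ε / 2 := by
    have : ‖a k‖ ^ 2 ≤ R ^ 2 := by gcongr; exact ha k
    calc δ * ‖a k‖ ^ 2 ≤ δ * (R ^ 2 + 1) := by gcongr; linarith
      _ = ε / 2 := by rw [hδ_def]; field_simp
  have := le_abs_self (∑' n, max 0 (‖w n‖ * ‖a k n‖ - δ * ‖a k n‖ ^ 2))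
  linarith

theorem tendsto_inner_re {R : ℝ} (w : L2 d) {a : ℕ → L2 d} (ha : ∀ k, ‖a k‖ ≤ R)
    (h0 : ∀ n, Tendsto (fun k => a k n) atTop (𝓝 0)) :
    Tendsto (fun k => (inner ℂ w (a k)).re) atTop (𝓝 0) := by
  refine squeeze_zero_norm (fun k => ?_) (tendsto_tsum_norm_mul_norm w ha h0)
  refine (Complex.abs_re_le_norm _).trans ?_
  rw [lp.inner_eq_tsum]
  refine tsum_of_norm_bounded (summable_norm_mul_norm w (a k)).hasSum fun n => ?_
  exact norm_inner_le_norm _ _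

/-- Compactness of a countable product of discs gives the subsequence; the uniform norm bound keeps
the limit in `ℓ²`. -/
theorem exists_subseq_tendsto {R : ℝ} {v : ℕ → L2 d} (hv : ∀ k, ‖v k‖ ≤ R) :
    ∃ (q : L2 d) (φ : ℕ → ℕ), StrictMono φ ∧
      ∀ n, Tendsto (fun k => v (φ k) n) atTop (𝓝 (q n)) := by
  have hc : IsCompact (Set.univ.pi fun _ : Fin d → ℤ => Metric.closedBall (0 : ℂ) R) :=
    isCompact_univ_pi fun _ => isCompact_closedBall _ _
  obtain ⟨a, -, φ, hφ, ha⟩ := hc.tendsto_subseq (x := fun k n => v k n) fun k n _ => by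
    simpa using (norm_apply_le (v k) n).trans (hv k)
  have hm : Memℓp a 2 := by
    refine lp.memℓp_of_tendsto (l := atTop) (F := fun k => v (φ k)) ?_ ha
    refine isBounded_iff_forall_norm_le.2 ⟨R, ?_⟩
    rintro _ ⟨k, rfl⟩
    exact hv _
  exact ⟨⟨a, hm⟩, φ, hφ, fun n => tendsto_pi_nhds.1 ha n⟩

/-! ### Scaling and existence of minimizers -/

theorem energy_smul (hs : Summable (fun m : Fin d → ℤ => J (latticeNorm m)))
    (hJ : ∀ k, 0 ≤ J k) {c : ℝ} (hc : 0 ≤ c) (u : L2 d) :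
    energy J p ((c : ℂ) • u) =
      c ^ 2 * (quadForm J u / 2) - c ^ (p + 1) * (powerSum p u / (p + 1)) := by
  rw [energy, quadForm_smul hs hJ, powerSum_smul hc]
  ring

theorem mass_smul {c : ℝ} (u : L2 d) : mass ((c : ℂ) • u) = c ^ 2 * mass u := by
  rw [mass, mass, norm_smul, mul_pow, Complex.norm_real, Real.norm_eq_abs, sq_abs]

/-- Scale `u` up to mass `ν` by `t ≥ 1`. The quadratic part gains `t²` and the nonlinear part `t²
t^(p-1)`, so undoing the scaling leaves a surplus, strict for `t > 1` because the power sum is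
positive. This plays the role of strict subadditivity. -/
theorem le_energy_of_mass_le (hs : Summable (fun m : Fin d → ℤ => J (latticeNorm m)))
    (hJ : ∀ k, 0 ≤ J k) (hp : 1 < p) {ν I : ℝ} (hν : 0 < ν)
    (hI : ∀ v : L2 d, mass v = ν → I ≤ energy J p v) {u : L2 d} (hu : u ≠ 0)
    (hm : mass u ≤ ν) :
    mass u / ν * I ≤ energy J p u ∧ (mass u < ν → mass u / ν * I < energy J p u) := by
  have hm0 : 0 < mass u := by rw [mass]; positivity
  set t := √(ν / mass u) with ht
  have ht2 : t ^ 2 = ν / mass u := Real.sq_sqrt (by positivity)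
  have ht0 : 0 < t := Real.sqrt_pos.2 (by positivity)
  have h1 := hI ((t : ℂ) • u) (by rw [mass_smul, ht2]; field_simp)
  have h2 : t ^ (p + 1) = t ^ 2 * t ^ (p - 1) := by
    rw [← Real.rpow_two, ← Real.rpow_add ht0]; congr 1; ring
  rw [energy_smul hs hJ ht0.le, h2] at h1
  have h3 : mass u / ν * I ≤ quadForm J u / 2 - t ^ (p - 1) * (powerSum p u / (p + 1)) := by
    have : mass u / ν = (t ^ 2)⁻¹ := by rw [ht2, inv_div]
    rw [this, inv_mul_le_iff₀ (by positivity)]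
    linarith
  have hN : 0 < powerSum p u / (p + 1) := div_pos (powerSum_pos hp hu) (by linarith)
  have h1t : 1 ≤ t ^ (p - 1) := by
    refine Real.one_le_rpow ?_ (by linarith)
    exact Real.one_le_sqrt.2 ((one_le_div hm0).2 hm)
  rw [energy]
  refine ⟨by nlinarith, fun hlt => ?_⟩
  have h1t : 1 < t ^ (p - 1) := by
    refine Real.one_lt_rpow ?_ (by linarith)
    rw [ht, Real.lt_sqrt zero_le_one, one_pow]
    exact (one_lt_div hm0).2 hlt
  nlinarith

theorem energy_zero (hp : 1 < p) : energy J p (0 : L2 d) = 0 := by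
  have h : quadForm J (0 : L2 d) = 0 := by simp [quadForm]
  have h' : powerSum p (0 : L2 d) = 0 := by
    simp [powerSum, Real.zero_rpow (by linarith : p + 1 ≠ 0)]
  simp [energy, h, h']

theorem neg_le_energy (hs : Summable (fun m : Fin d → ℤ => J (latticeNorm m)))
    (hJ : ∀ k, 0 ≤ J k) (hp : 1 < p) {u : L2 d} {A : ℝ} (hA : ∀ n, ‖u n‖ ≤ A) :
    -(A ^ (p - 1) * mass u / (p + 1)) ≤ energy J p u := by
  have h1 := quadForm_nonneg hs hJ u
  have h2 : powerSum p u / (p + 1) ≤ A ^ (p - 1) * mass u / (p + 1) :=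
    div_le_div_of_nonneg_right (powerSum_le hp hA) (by linarith)
  rw [energy]
  linarith

theorem energy_translation (hs : Summable (fun m : Fin d → ℤ => J (latticeNorm m)))
    (hJ : ∀ k, 0 ≤ J k) (k : Fin d → ℤ) (u : L2 d) :
    energy J p (translation k u) = energy J p u := by
  rw [energy, energy, quadForm_translation hs hJ, powerSum_translation]

/-- `A` solves `A^(p-1) ν / (p+1) = -b`: a state everywhere below `A` in modulus would have energy
at least `b`. A site where `A` is reached is moved to the origin. -/
theorem exists_energy_lt_and_le_norm (hs : Summable (fun m : Fin d → ℤ => J (latticeNorm m)))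
    (hJ : ∀ k, 0 ≤ J k) (hp : 1 < p) {ν b : ℝ} (hν : 0 < ν) (hb : b < 0) :
    ∃ A : ℝ, 0 < A ∧ ∀ v : L2 d, mass v = ν → energy J p v < b →
      ∃ w : L2 d, mass w = ν ∧ energy J p w = energy J p v ∧ A ≤ ‖w 0‖ := by
  have hc : 0 < -b * (p + 1) / ν := div_pos (mul_pos (by linarith) (by linarith)) hν
  refine ⟨(-b * (p + 1) / ν) ^ (1 / (p - 1)), Real.rpow_pos_of_pos hc _, fun v hv hvb => ?_⟩
  set A := (-b * (p + 1) / ν) ^ (1 / (p - 1)) with hA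
  obtain ⟨n, hn⟩ : ∃ n, A ≤ ‖v n‖ := by
    by_contra! h
    have h1 := neg_le_energy hs hJ hp fun n => (h n).le
    have h2 : A ^ (p - 1) = -b * (p + 1) / ν := by
      rw [hA, ← Real.rpow_mul hc.le, one_div, inv_mul_cancel₀ (by linarith), Real.rpow_one]
    rw [h2, hv, div_mul_cancel₀ _ hν.ne', mul_div_cancel_right₀ _ (by linarith)] at h1
    linarith
  exact ⟨translation n v, by rw [mass, (translation n).norm_map]; exact hv,
    energy_translation hs hJ n v, by simpa using hn⟩

theorem exists_minimizer (hs : Summable (fun m : Fin d → ℤ => J (latticeNorm m)))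
    (hJ : ∀ k, 0 ≤ J k) (hp : 1 < p) {ν : ℝ} (hν : 0 < ν) {q₀ : L2 d} (hq₀ : mass q₀ = ν)
    (hE : energy J p q₀ < 0) :
    ∃ q : L2 d, mass q = ν ∧ ∀ v : L2 d, mass v = ν → energy J p q ≤ energy J p v := by
  set S : Set ℝ := energy J p '' {v : L2 d | mass v = ν} with hS
  have hSne : S.Nonempty := ⟨_, q₀, hq₀, rfl⟩
  have hnorm : ∀ v : L2 d, mass v = ν → ‖v‖ = √ν := fun v hv => by
    rw [← hv, mass, Real.sqrt_sq (norm_nonneg _)]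
  have hSb : BddBelow S := by
    refine ⟨-((√ν) ^ (p - 1) * ν / (p + 1)), ?_⟩
    rintro _ ⟨v, hv, rfl⟩
    have := neg_le_energy hs hJ hp (u := v) (A := √ν)
      fun n => (norm_apply_le v n).trans_eq (hnorm v hv)
    rwa [show mass v = ν from hv] at this
  set I := sInf S with hI_def
  have hI : ∀ v : L2 d, mass v = ν → I ≤ energy J p v := fun v hv => csInf_le hSb ⟨v, hv, rfl⟩
  have hI0 : I < 0 := (hI q₀ hq₀).trans_lt hE
  obtain ⟨A, hA, hAw⟩ := exists_energy_lt_and_le_norm (d := d) hs hJ hp hν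
    (show I / 2 < 0 by linarith)
  -- Staying below `I / 2 < 0` gives one lower bound `A` for the whole minimizing sequence.
  have hex : ∀ k : ℕ, ∃ w : L2 d,
      mass w = ν ∧ energy J p w ≤ I + 1 / ((k : ℝ) + 1) ∧ A ≤ ‖w 0‖ := by
    intro k
    have hpos : (0 : ℝ) < 1 / ((k : ℝ) + 1) := by positivity
    obtain ⟨_, ⟨v, hv, rfl⟩, hlt⟩ := exists_lt_of_csInf_lt hSne
      (show sInf S < min (I + 1 / ((k : ℝ) + 1)) (I / 2) from
        lt_min (by linarith) (by linarith))
    obtain ⟨w, hw1, hw2, hw3⟩ := hAw v hv (hlt.trans_le (min_le_right _ _))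
    exact ⟨w, hw1, hw2 ▸ (hlt.trans_le (min_le_left _ _)).le, hw3⟩
  choose v hv hvE hvA using hex
  obtain ⟨q, φ, hφ, hq⟩ := exists_subseq_tendsto fun k => (hnorm _ (hv k)).le
  set a : ℕ → L2 d := fun k => v (φ k) - q with ha_def
  have hva : ∀ k, v (φ k) = q + a k := fun k => by simp [ha_def]
  have haR : ∀ k, ‖a k‖ ≤ √ν + ‖q‖ := fun k => by
    refine (norm_sub_le _ _).trans ?_
    rw [hnorm _ (hv _)]
  have ha0 : ∀ n, Tendsto (fun k => a k n) atTop (𝓝 0) := fun n => by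
    simpa [ha_def] using (hq n).sub_const (q n)
  have hqA : A ≤ ‖q 0‖ := ge_of_tendsto (hq 0).norm (Eventually.of_forall fun k => hvA _)
  have hq0 : q ≠ 0 := fun h => by simp [h] at hqA; linarith
  have hμ0 : 0 < mass q := by rw [mass]; positivity
  have hmass_a : ∀ k, mass (a k) = ν - mass q - 2 * (inner ℂ q (a k)).re := fun k => by
    have h1 := norm_add_sq (𝕜 := ℂ) q (a k)
    rw [← hva] at h1
    have h2 := hv (φ k)
    rw [mass] at h2
    rw [h2, RCLike.re_eq_complex_re] at h1
    rw [mass, mass]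
    linarith
  have hmass_lim : Tendsto (fun k => mass (a k)) atTop (𝓝 (ν - mass q)) := by
    simp_rw [hmass_a]
    simpa using ((tendsto_inner_re q haR ha0).const_mul 2).const_sub (ν - mass q)
  have hμν : mass q ≤ ν := by
    have : 0 ≤ ν - mass q := ge_of_tendsto hmass_lim (Eventually.of_forall fun k => by
      rw [mass]; positivity)
    linarith
  obtain ⟨z, hz⟩ := quadForm_add hs hJ q
  set C := 2 * (p + 1) * (2 * (√ν + ‖q‖)) ^ (p - 1) with hC
  -- Pass to the limit in `H[q + aₖ] ≥ H[q] + H[aₖ] - o(1)`, with `H[aₖ]` bounded below by the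
  -- scaling estimate.
  have hmain : energy J p q + (ν - mass q) / ν * I ≤ I := by
    have hl : Tendsto (fun k => energy J p q + mass (a k) / ν * I + (inner ℂ z (a k)).re / 2 -
        C * (∑' n, ‖q n‖ * ‖a k n‖) / (p + 1)) atTop
        (𝓝 (energy J p q + (ν - mass q) / ν * I)) := by
      have := (((hmass_lim.div_const ν).mul_const I).const_add (energy J p q)).add
        ((tendsto_inner_re z haR ha0).div_const 2) |>.sub
        (((tendsto_tsum_norm_mul_norm q haR ha0).const_mul C).div_const (p + 1))
      simpa using this
    have hr : Tendsto (fun k : ℕ => I + 1 / ((φ k : ℝ) + 1)) atTop (𝓝 I) := by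
      have := (tendsto_one_div_add_atTop_nhds_zero_nat (𝕜 := ℝ)).comp hφ.tendsto_atTop
      simpa [Function.comp_def] using this.const_add I
    refine le_of_tendsto_of_tendsto hl hr ?_
    -- As `q` carries positive mass, the remainder eventually has mass below `ν`, as the scaling
    -- estimate requires.
    filter_upwards [hmass_lim.eventually_lt_const (show ν - mass q < ν by linarith)] with k hk
    refine le_trans ?_ (hvE (φ k))
    have h1 : mass (a k) / ν * I ≤ energy J p (a k) := by
      by_cases h : a k = 0
      · simp [h, energy_zero hp, mass]
      · exact (le_energy_of_mass_le hs hJ hp hν hI h hk.le).1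
    have h2 := powerSum_add_le hp (u := q) (v := a k) (R := √ν + ‖q‖)
      (le_add_of_nonneg_left (Real.sqrt_nonneg _)) (haR k)
    have h3 := div_le_div_of_nonneg_right h2 (by linarith : 0 ≤ p + 1)
    rw [← hC, add_div, add_div] at h3
    have h4 := hz (a k)
    rw [hva k]
    simp only [energy] at h1 ⊢
    linarith
  have hsplit : (ν - mass q) / ν * I = I - mass q / ν * I := by field_simp
  rw [hsplit] at hmain
  -- The limit now satisfies `H[q] ≤ (M[q] / ν) I`, against the strict scaling estimate unless all
  -- mass is kept.
  have hq_mass : mass q = ν := by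
    by_contra h
    have := (le_energy_of_mass_le hs hJ hp hν hI hq0 hμν).2 (lt_of_le_of_ne hμν h)
    linarith
  rw [hq_mass, div_self hν.ne'] at hmain
  exact ⟨q, hq_mass, fun w hw => le_trans (by linarith) (hI w hw)⟩

theorem isGroundState_of_forall_le {ν : ℝ} {q : L2 d} (hq : mass q = ν)
    (h : ∀ v : L2 d, mass v = ν → energy J p q ≤ energy J p v) : IsGroundState J p ν q :=
  ⟨hq, le_antisymm (le_iInf₂ fun v hv => EReal.coe_le_coe_iff.2 (h v hv))
    (iInf₂_le (f := fun (q : L2 d) (_ : q ∈ {q : L2 d | mass q = ν}) =>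
      (energy J p q : EReal)) q hq)⟩

theorem minEnergy_le {ν : ℝ} {q : L2 d} (hq : mass q = ν) :
    minEnergy d J p ν ≤ (energy J p q : EReal) :=
  iInf₂_le (f := fun (q : L2 d) (_ : q ∈ {q : L2 d | mass q = ν}) =>
      (energy J p q : EReal)) q hq

/-- Both sides of the inequality are homogeneous of degree `p + 1`, and at mass `ν` it says exactly
that the energy is nonnegative. -/
theorem exists_energy_neg (hs : Summable (fun m : Fin d → ℤ => J (latticeNorm m)))
    (hJ : ∀ k, 0 ≤ J k) (hp : 1 < p) {ν : ℝ} (hν : 0 < ν) (h : ¬ GNInequality d J p ν) :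
    ∃ q : L2 d, mass q = ν ∧ energy J p q < 0 := by
  rw [GNInequality] at h
  push Not at h
  obtain ⟨q, hq⟩ := h
  have hq0 : q ≠ 0 := by
    rintro rfl
    simp [powerSum, Real.zero_rpow (by linarith : p + 1 ≠ 0),
      Real.zero_rpow (by linarith : p - 1 ≠ 0)] at hq
  have hn : 0 < ‖q‖ := norm_pos_iff.2 hq0
  set t := √ν / ‖q‖ with ht
  have ht0 : 0 < t := by positivity
  refine ⟨(t : ℂ) • q, ?_, ?_⟩
  · rw [mass_smul, mass, ht, div_pow, Real.sq_sqrt hν.le]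
    field_simp
  · have h2 : t ^ (p + 1) = t ^ 2 * t ^ (p - 1) := by
      rw [← Real.rpow_two, ← Real.rpow_add ht0]; congr 1; ring
    have h3 : t ^ (p - 1) * (ν ^ (-((p - 1) / 2)) * ‖q‖ ^ (p - 1)) = 1 := by
      rw [ht, Real.div_rpow (Real.sqrt_nonneg _) hn.le, Real.sqrt_eq_rpow, ← Real.rpow_mul hν.le,
        Real.rpow_neg hν.le, one_div_mul_eq_div]
      field_simp
    have htp : 0 < t ^ (p - 1) := by positivity
    have h4 := mul_lt_mul_of_pos_left hq htp
    have h5 : t ^ (p - 1) * ((p + 1) / 2 * ν ^ (-((p - 1) / 2)) * ‖q‖ ^ (p - 1) * quadForm J q) =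
        (p + 1) / 2 * quadForm J q := by
      linear_combination ((p + 1) / 2 * quadForm J q) * h3
    rw [h5] at h4
    have h6 : quadForm J q / 2 < t ^ (p - 1) * (powerSum p q / (p + 1)) := by
      rw [← mul_div_assoc, lt_div_iff₀ (by linarith)]
      linarith
    rw [energy_smul hs hJ ht0.le, h2]
    have := mul_lt_mul_of_pos_left h6 (by positivity : 0 < t ^ 2)
    linarith

theorem groundState_of_excitationThreshold_lt
    (hs : Summable (fun m : Fin d → ℤ => J (latticeNorm m)))
    (hJ : ∀ k, 0 ≤ J k) (hp : 1 < p) {ν : ℝ} (hν : 0 < ν) (h : excitationThreshold d J p < ν) :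
    minEnergy d J p ν < 0 ∧ ∃ q : L2 d, IsGroundState J p ν q := by
  have hGN : ¬ GNInequality d J p ν := fun hG =>
    h.not_ge (le_csSup (bddAbove_gnInequality hp) ⟨hν, hG⟩)
  obtain ⟨q₀, hq₀, hE⟩ := exists_energy_neg hs hJ hp hν hGN
  obtain ⟨q, hq, hmin⟩ := exists_minimizer hs hJ hp hν hq₀ hE
  exact ⟨(minEnergy_le hq₀).trans_lt (by exact_mod_cast hE), q,
    isGroundState_of_forall_le hq hmin⟩

/-! ### Slowly varying profiles -/

theorem latticeNorm_add_le (m n : Fin d → ℤ) :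
    latticeNorm (m + n) ≤ latticeNorm m + latticeNorm n := by
  rw [latticeNorm, latticeNorm, latticeNorm, ← Finset.sum_add_distrib]
  exact Finset.sum_le_sum fun i _ => Int.natAbs_add_le _ _

theorem summable_pow_natAbs {r : ℝ} (hr0 : 0 ≤ r) (hr1 : r < 1) :
    Summable fun k : ℤ => r ^ k.natAbs :=
  Summable.of_nat_of_neg (by simpa using summable_geometric_of_lt_one hr0 hr1)
    (by simpa using summable_geometric_of_lt_one hr0 hr1)

/-- The summand factors over coordinates, and a finite set lies in the product of its coordinate
projections. -/
theorem summable_pow_latticeNorm {r : ℝ} (hr0 : 0 ≤ r) (hr1 : r < 1) :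
    Summable fun n : Fin d → ℤ => r ^ latticeNorm n := by
  refine summable_of_sum_le (fun _ => by positivity) (c := (∑' k : ℤ, r ^ k.natAbs) ^ d)
    fun s => ?_
  calc ∑ n ∈ s, r ^ latticeNorm n
      ≤ ∑ n ∈ Fintype.piFinset fun i => s.image fun n => n i, r ^ latticeNorm n := by
        refine Finset.sum_le_sum_of_subset_of_nonneg (fun n hn => ?_) fun _ _ _ => by positivity
        exact Fintype.mem_piFinset.2 fun i => Finset.mem_image_of_mem (fun n => n i) hn
    _ = ∏ i : Fin d, ∑ k ∈ s.image fun n => n i, r ^ k.natAbs := by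
        rw [Finset.prod_univ_sum]
        exact Finset.sum_congr rfl fun n _ => by rw [latticeNorm, Finset.prod_pow_eq_pow_sum]
    _ ≤ ∏ i : Fin d, ∑' k : ℤ, r ^ k.natAbs :=
        Finset.prod_le_prod (fun _ _ => Finset.sum_nonneg fun _ _ => by positivity)
          fun i _ => (summable_pow_natAbs hr0 hr1).sum_le_tsum _ fun _ _ => by positivity
    _ = _ := by simp

theorem memℓp_exp_latticeNorm {ε : ℝ} (hε : 0 < ε) :
    Memℓp (fun n : Fin d → ℤ => (Real.exp (-ε * latticeNorm n) : ℂ)) 2 := by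
  refine memℓp_two_of_summable ?_
  refine (summable_pow_latticeNorm (r := Real.exp (-(2 * ε))) (Real.exp_pos _).le
    ((Real.exp_lt_exp.2 (by linarith)).trans_eq Real.exp_zero)).congr fun n => ?_
  rw [Complex.norm_real, Real.norm_of_nonneg (Real.exp_pos _).le, ← Real.exp_nat_mul,
    ← Real.exp_nat_mul]
  congr 1
  push_cast
  ring

/-- The exponentially decaying profile `n ↦ exp (-ε |n|)`. -/
noncomputable def expProfile (d : ℕ) {ε : ℝ} (hε : 0 < ε) : L2 d :=
  ⟨_, memℓp_exp_latticeNorm hε⟩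

theorem expProfile_apply {ε : ℝ} (hε : 0 < ε) (n : Fin d → ℤ) :
    expProfile d hε n = (Real.exp (-ε * latticeNorm n) : ℂ) := rfl

theorem expProfile_ne_zero {ε : ℝ} (hε : 0 < ε) : expProfile d hε ≠ 0 := fun h => by
  have := congrArg (fun u : L2 d => u 0) h
  simp [expProfile_apply] at this

theorem norm_le_mul_norm_of_forall {u v : L2 d} {c : ℝ} (hc : 0 ≤ c)
    (h : ∀ n, ‖u n‖ ≤ c * ‖v n‖) : ‖u‖ ≤ c * ‖v‖ := by
  refine le_of_sq_le_sq ?_ (by positivity)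
  rw [mul_pow]
  refine hasSum_le (fun n => ?_) (hasSum_norm_sq u) ((hasSum_norm_sq v).mul_left _)
  rw [← mul_pow]
  exact pow_le_pow_left₀ (norm_nonneg _) (h n) 2

/-- By the triangle inequality, a shift by `m` changes the profile at each site by a factor between
`exp (-ε|m|)` and `exp (ε|m|)`. -/
theorem norm_translation_expProfile_sub_le {ε : ℝ} (hε : 0 < ε) (m : Fin d → ℤ) :
    ‖translation m (expProfile d hε) - expProfile d hε‖ ≤
      (Real.exp (ε * latticeNorm m) - 1) * ‖expProfile d hε‖ := by
  have hx1 : 1 ≤ Real.exp (ε * latticeNorm m) := Real.one_le_exp (by positivity)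
  refine norm_le_mul_norm_of_forall (by linarith) fun n => ?_
  rw [lp.coeFn_sub, Pi.sub_apply, translation_apply, expProfile_apply, expProfile_apply,
    ← Complex.ofReal_sub, Complex.norm_real, Complex.norm_real,
    Real.norm_of_nonneg (Real.exp_pos _).le, Real.norm_eq_abs, abs_le]
  have h1 : (latticeNorm (n + m) : ℝ) ≤ latticeNorm n + latticeNorm m := by
    exact_mod_cast latticeNorm_add_le n m
  have h2 : (latticeNorm n : ℝ) ≤ latticeNorm (n + m) + latticeNorm m := by
    have := latticeNorm_add_le (n + m) (-m)
    rw [latticeNorm_neg, add_neg_cancel_right] at this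
    exact_mod_cast this
  have hy := Real.exp_pos (-ε * latticeNorm n)
  have h3 : Real.exp (-ε * latticeNorm (n + m)) ≤
      Real.exp (ε * latticeNorm m) * Real.exp (-ε * latticeNorm n) := by
    rw [← Real.exp_add]
    exact Real.exp_le_exp.2 (by nlinarith)
  have h4 : Real.exp (-ε * latticeNorm n) ≤
      Real.exp (ε * latticeNorm m) * Real.exp (-ε * latticeNorm (n + m)) := by
    rw [← Real.exp_add]
    exact Real.exp_le_exp.2 (by nlinarith)
  constructor
  · nlinarith [mul_le_mul_of_nonneg_left h4 (sub_nonneg.2 hx1)]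
  · linarith

/-- Each displacement contributes a vanishing share as `ε → 0`, dominated by `2 J_{|m|}` because
translations are isometries. No moment of `J` is needed. -/
theorem tendsto_quadForm_expProfile (hs : Summable (fun m : Fin d → ℤ => J (latticeNorm m)))
    (hJ : ∀ k, 0 ≤ J k) :
    Tendsto (fun k : ℕ => quadForm J (expProfile d (ε := 1 / ((k : ℝ) + 1)) (by positivity)) /
      ‖expProfile d (ε := 1 / ((k : ℝ) + 1)) (by positivity)‖ ^ 2) atTop (𝓝 0) := by
  set u : ℕ → L2 d := fun k => expProfile d (ε := 1 / ((k : ℝ) + 1)) (by positivity) with hu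
  have hu0 : ∀ k, 0 < ‖u k‖ := fun k => norm_pos_iff.2 (expProfile_ne_zero _)
  have h1 : ∀ k, quadForm J (u k) / ‖u k‖ ^ 2 = ∑' m : Fin d → ℤ,
      J (latticeNorm m) * (‖translation m (u k) - u k‖ ^ 2 / 2) / ‖u k‖ ^ 2 :=
    fun k => ((hasSum_quadForm hs hJ (u k)).div_const _).tsum_eq.symm
  show Tendsto (fun k => quadForm J (u k) / ‖u k‖ ^ 2) atTop (𝓝 0)
  simp_rw [h1]
  have hnn : ∀ k (m : Fin d → ℤ),
      0 ≤ J (latticeNorm m) * (‖translation m (u k) - u k‖ ^ 2 / 2) / ‖u k‖ ^ 2 :=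
    fun k m => div_nonneg (mul_nonneg (hJ _) (by positivity)) (by positivity)
  have := tendsto_tsum_of_dominated_convergence (𝓕 := atTop)
    (f := fun k (m : Fin d → ℤ) =>
      J (latticeNorm m) * (‖translation m (u k) - u k‖ ^ 2 / 2) / ‖u k‖ ^ 2)
    (g := fun _ => (0 : ℝ)) (hs.mul_right 2) (fun m => ?_)
    (Eventually.of_forall fun k m => ?_)
  · simpa using this
  · have hlim : Tendsto (fun k : ℕ => J (latticeNorm m) *
        ((Real.exp (1 / ((k : ℝ) + 1) * latticeNorm m) - 1) ^ 2 / 2)) atTop (𝓝 0) := by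
      have h := (tendsto_one_div_add_atTop_nhds_zero_nat (𝕜 := ℝ)).mul_const
        (latticeNorm m : ℝ)
      have h' := ((((Real.continuous_exp.tendsto _).comp h).sub_const 1).pow 2).div_const 2
      simpa using h'.const_mul (J (latticeNorm m))
    refine squeeze_zero (fun k => hnn k m) (fun k => ?_) hlim
    rw [mul_div_assoc]
    refine mul_le_mul_of_nonneg_left ?_ (hJ _)
    rw [div_le_iff₀ (by have := hu0 k; positivity), div_mul_eq_mul_div, ← mul_pow]
    have := norm_translation_expProfile_sub_le (d := d)
      (show (0 : ℝ) < 1 / ((k : ℝ) + 1) by positivity) m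
    gcongr
  · rw [Real.norm_of_nonneg (hnn k m), mul_div_assoc]
    refine mul_le_mul_of_nonneg_left ?_ (hJ _)
    rw [div_le_iff₀ (by have := hu0 k; positivity)]
    have h2 : ‖translation m (u k) - u k‖ ≤ 2 * ‖u k‖ := by
      refine (norm_sub_le _ _).trans ?_
      rw [(translation m).norm_map, two_mul]
    have h3 := pow_le_pow_left₀ (norm_nonneg _) h2 2
    nlinarith

theorem exists_tendsto_quadForm_zero (hs : Summable (fun m : Fin d → ℤ => J (latticeNorm m)))
    (hJ : ∀ k, 0 ≤ J k) {ν : ℝ} (hν : 0 < ν) :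
    ∃ v : ℕ → L2 d, (∀ k, mass (v k) = ν) ∧
      Tendsto (fun k => quadForm J (v k)) atTop (𝓝 0) := by
  have h := tendsto_quadForm_expProfile (d := d) hs hJ
  set u : ℕ → L2 d := fun k => expProfile d (ε := 1 / ((k : ℝ) + 1)) (by positivity) with hu
  have hu0 : ∀ k, 0 < ‖u k‖ := fun k => norm_pos_iff.2 (expProfile_ne_zero _)
  have hsq : ∀ k, (√ν / ‖u k‖) ^ 2 = ν / ‖u k‖ ^ 2 := fun k => by
    rw [div_pow, Real.sq_sqrt hν.le]
  refine ⟨fun k => ((√ν / ‖u k‖ : ℝ) : ℂ) • u k, fun k => ?_, ?_⟩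
  · have := hu0 k
    rw [mass_smul, hsq, mass]
    field_simp
  · have h' := h.const_mul ν
    rw [mul_zero] at h'
    refine h'.congr fun k => ?_
    rw [quadForm_smul hs hJ, hsq]
    ring

/-! ### Below the threshold -/

theorem energy_pos_of_gnInequality (hd : 1 ≤ d)
    (hs : Summable (fun m : Fin d → ℤ => J (latticeNorm m)))
    (hJ : ∀ k, 0 ≤ J k) (hJ1 : 0 < J 1) (hp : 1 < p) {ν ν' : ℝ} (hν : 0 < ν) (hlt : ν < ν')
    (hG : GNInequality d J p ν') {q : L2 d} (hq : mass q = ν) : 0 < energy J p q := by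
  have hq0 : q ≠ 0 := by
    rintro rfl
    rw [mass, norm_zero] at hq
    norm_num at hq
    exact hν.ne hq
  have hQ := quadForm_pos hd hs hJ hJ1 hq0
  have h1 := hG q
  have hν' : 0 < ν' := hν.trans hlt
  have h2 : ‖q‖ ^ (p - 1) = ν ^ ((p - 1) / 2) := by
    rw [← hq, mass, ← Real.rpow_two, ← Real.rpow_mul (norm_nonneg _)]
    congr 1; ring
  have h3 : ν ^ ((p - 1) / 2) < ν' ^ ((p - 1) / 2) :=
    Real.rpow_lt_rpow hν.le hlt (by linarith)
  have h4 : ν' ^ (-((p - 1) / 2)) * ν ^ ((p - 1) / 2) < 1 := by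
    rw [Real.rpow_neg hν'.le, inv_mul_lt_iff₀ (by positivity)]
    linarith
  rw [h2, mul_assoc ((p + 1) / 2)] at h1
  have h5 : (p + 1) / 2 * (ν' ^ (-((p - 1) / 2)) * ν ^ ((p - 1) / 2)) * quadForm J q <
      (p + 1) / 2 * quadForm J q := by
    have : 0 < (p + 1) / 2 := by linarith
    nlinarith [mul_pos this hQ]
  have h6 : powerSum p q / (p + 1) < quadForm J q / 2 := by
    rw [div_lt_iff₀ (by linarith)]
    linarith
  rw [energy]
  linarith

theorem no_groundState_of_lt_excitationThreshold (hd : 1 ≤ d)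
    (hs : Summable (fun m : Fin d → ℤ => J (latticeNorm m)))
    (hJ : ∀ k, 0 ≤ J k) (hJ1 : 0 < J 1) (hp : 1 < p) {ν : ℝ} (hν : 0 < ν)
    (h : ν < excitationThreshold d J p) :
    minEnergy d J p ν = 0 ∧ ¬ ∃ q : L2 d, IsGroundState J p ν q := by
  -- On the empty set `sSup` takes the value `0`, which is incompatible with `0 < ν < ν₀`.
  have hne : {ν : ℝ | 0 < ν ∧ GNInequality d J p ν}.Nonempty := by
    by_contra hne
    rw [Set.not_nonempty_iff_eq_empty] at hne
    rw [excitationThreshold, hne, Real.sSup_empty] at h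
    linarith
  obtain ⟨ν', ⟨-, hG⟩, hlt⟩ := exists_lt_of_lt_csSup hne h
  have hpos : ∀ q : L2 d, mass q = ν → 0 < energy J p q := fun q hq =>
    energy_pos_of_gnInequality hd hs hJ hJ1 hp hν hlt hG hq
  have hI : minEnergy d J p ν = 0 := by
    refine le_antisymm ?_ (le_iInf₂ fun q hq => by exact_mod_cast (hpos q hq).le)
    obtain ⟨v, hv, hlim⟩ := exists_tendsto_quadForm_zero (d := d) hs hJ hν
    have hlim' := (continuous_coe_real_ereal.tendsto _).comp (hlim.div_const 2)
    rw [zero_div, EReal.coe_zero] at hlim'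
    refine ge_of_tendsto' hlim' fun k => (minEnergy_le (hv k)).trans ?_
    refine EReal.coe_le_coe_iff.2 ?_
    rw [energy]
    exact sub_le_self _ (div_nonneg (powerSum_nonneg _) (by linarith))
  refine ⟨hI, fun ⟨q, hq, hqE⟩ => ?_⟩
  rw [hI] at hqE
  exact (hpos q hq).ne' (by exact_mod_cast hqE)

/-! ### Faber–Krahn inequality -/

section FaberKrahn

/-- For `n ∈ S`, at most `|S| ≤ |H| / 2` displacements keep `n + h` in `S`. Each of the others costs
the full `‖g n‖²`, since `g` vanishes at `n + h`. -/
theorem card_mul_norm_sq_le {S H : Finset (Fin d → ℤ)} (hSH : 2 * S.card ≤ H.card) {g : L2 d}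
    (hg : ∀ n ∉ S, g n = 0) :
    (H.card : ℝ) / 2 * ‖g‖ ^ 2 ≤ ∑ h ∈ H, ‖translation h g - g‖ ^ 2 := by
  classical
  have h1 : ∀ h ∈ H, ∑ n ∈ S, (if n + h ∉ S then ‖g n‖ ^ 2 else 0) ≤
      ‖translation h g - g‖ ^ 2 := by
    intro h _
    refine le_trans (Finset.sum_le_sum fun n _ => ?_)
      (sum_le_hasSum S (fun _ _ => by positivity) (hasSum_norm_sq (translation h g - g)))
    split_ifs with hn
    · positivity
    · simp [hg _ hn]
  have h2 : ‖g‖ ^ 2 = ∑ n ∈ S, ‖g n‖ ^ 2 :=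
    (hasSum_norm_sq g).unique (hasSum_sum_of_ne_finset_zero fun n hn => by simp [hg n hn])
  refine le_trans ?_ (Finset.sum_le_sum h1)
  rw [Finset.sum_comm, h2, Finset.mul_sum]
  refine Finset.sum_le_sum fun n _ => ?_
  rw [← Finset.sum_filter, Finset.sum_const, nsmul_eq_mul]
  refine mul_le_mul_of_nonneg_right ?_ (by positivity)
  have h3 : (H.filter fun h => n + h ∈ S).card ≤ S.card :=
    Finset.card_le_card_of_injOn (fun h => n + h) (fun h hh => (Finset.mem_filter.1 hh).2)
      (fun a _ b _ hab => add_left_cancel hab)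
  have h4 := H.card_filter_add_card_filter_not (fun h => n + h ∈ S)
  have h5 : H.card ≤ 2 * (H.filter fun h => n + h ∉ S).card := by omega
  have h6 : (H.card : ℝ) ≤ 2 * (H.filter fun h => n + h ∉ S).card := by exact_mod_cast h5
  linarith

/-- The box `[K, K + R)^d` of lattice displacements. -/
noncomputable def box (d K R : ℕ) : Finset (Fin d → ℤ) :=
  Fintype.piFinset fun _ => Finset.Ico (K : ℤ) (K + R)

theorem card_box (K R : ℕ) : (box d K R).card = R ^ d := by
  simp [box, Fintype.card_piFinset]

theorem latticeNorm_mem_box (hd : 1 ≤ d) {K R : ℕ} (hR : 1 ≤ R) {h : Fin d → ℤ}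
    (hh : h ∈ box d K R) : K ≤ latticeNorm h ∧ latticeNorm h ≤ d * (K + 1) * R := by
  have h1 : ∀ i, (K : ℤ) ≤ h i ∧ h i < K + R := fun i =>
    Finset.mem_Ico.1 (Fintype.mem_piFinset.1 hh i)
  constructor
  · have h2 : (h ⟨0, hd⟩).natAbs ≤ latticeNorm h :=
      Finset.single_le_sum (f := fun i => (h i).natAbs) (fun _ _ => Nat.zero_le _)
        (Finset.mem_univ _)
    have := h1 ⟨0, hd⟩
    omega
  · have h2 : ∀ i ∈ (Finset.univ : Finset (Fin d)), (h i).natAbs ≤ (K + 1) * R := by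
      intro i _
      have := h1 i
      have h3 : (h i).natAbs ≤ K + R := by omega
      nlinarith
    have := Finset.sum_le_card_nsmul _ _ _ h2
    simpa [latticeNorm, mul_assoc] using this

/-- With `R ≈ (2v)^(1/d)` the box has at least `2|S|` points; the factor `R^d` cancels and `R^(2s)`
becomes `v^(2s/d)`. -/
theorem norm_sq_le_of_box_bound (hd : 1 ≤ d)
    (hs : Summable (fun m : Fin d → ℤ => J (latticeNorm m))) (hJ : ∀ k, 0 ≤ J k) {s : ℝ}
    (hs0 : 0 < s) {C : ℝ} (hC : 0 < C) {K : ℕ}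
    (hbox : ∀ R : ℕ, 1 ≤ R → ∀ g : L2 d, ∑ h ∈ box d K R, ‖translation h g - g‖ ^ 2 ≤
      C * ((R : ℝ) ^ d * (R : ℝ) ^ (2 * s)) * quadForm J g)
    {v : ℝ} (hv : 1 ≤ v) {S : Finset (Fin d → ℤ)} (hS : (S.card : ℝ) ≤ v) {g : L2 d}
    (hg : ∀ n ∉ S, g n = 0) :
    ‖g‖ ^ 2 ≤ 2 * C * 4 ^ (2 * s) * v ^ (2 * s / d) * quadForm J g := by
  have hd0 : (0 : ℝ) < d := by exact_mod_cast hd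
  have hd1 : (1 : ℝ) ≤ d := by exact_mod_cast hd
  set x : ℝ := (2 * v) ^ (1 / (d : ℝ)) with hx
  have hx1 : 1 ≤ x := Real.one_le_rpow (by linarith) (by positivity)
  set R : ℕ := ⌈x⌉₊ with hR
  have hxR : x ≤ R := Nat.le_ceil x
  have hR1 : 1 ≤ R := by exact_mod_cast hx1.trans hxR
  have hR0 : (0 : ℝ) < R := by exact_mod_cast hR1
  have hRd : 2 * v ≤ (R : ℝ) ^ d := by
    have h1 : x ^ d = 2 * v := by
      rw [hx, ← Real.rpow_natCast, ← Real.rpow_mul (by linarith), one_div,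
        inv_mul_cancel₀ hd0.ne', Real.rpow_one]
    rw [← h1]
    exact pow_le_pow_left₀ (by linarith) hxR d
  -- Rounding up costs a factor two because `x ≥ 1`, and `2^(1/d) ≤ 2` gives the other.
  have hR4 : (R : ℝ) ≤ 4 * v ^ (1 / (d : ℝ)) := by
    have h1 : (R : ℝ) < x + 1 := Nat.ceil_lt_add_one (by linarith)
    have h2 : x = 2 ^ (1 / (d : ℝ)) * v ^ (1 / (d : ℝ)) :=
      Real.mul_rpow zero_le_two (by linarith)
    have h3 : (2 : ℝ) ^ (1 / (d : ℝ)) ≤ 2 := by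
      calc (2 : ℝ) ^ (1 / (d : ℝ)) ≤ 2 ^ (1 : ℝ) :=
            Real.rpow_le_rpow_of_exponent_le one_le_two ((div_le_one hd0).2 hd1)
        _ = 2 := Real.rpow_one 2
    have h4 : 0 ≤ v ^ (1 / (d : ℝ)) := Real.rpow_nonneg (by linarith) _
    nlinarith
  have hcard : 2 * S.card ≤ (box d K R).card := by
    rw [card_box]
    have : (2 * S.card : ℝ) ≤ (R : ℝ) ^ d := by linarith
    exact_mod_cast this
  have h1 := (card_mul_norm_sq_le hcard hg).trans (hbox R hR1 g)
  rw [card_box, Nat.cast_pow] at h1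
  have hQ := quadForm_nonneg hs hJ g
  have h2 : ‖g‖ ^ 2 ≤ 2 * C * (R : ℝ) ^ (2 * s) * quadForm J g := by
    have hp : (0 : ℝ) < (R : ℝ) ^ d := by positivity
    refine le_of_mul_le_mul_left ?_ hp
    linarith
  refine h2.trans ?_
  have h3 : (R : ℝ) ^ (2 * s) ≤ 4 ^ (2 * s) * v ^ (2 * s / d) := by
    calc (R : ℝ) ^ (2 * s) ≤ (4 * v ^ (1 / (d : ℝ))) ^ (2 * s) :=
          Real.rpow_le_rpow hR0.le hR4 (by linarith)
      _ = _ := by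
          rw [Real.mul_rpow (by norm_num) (Real.rpow_nonneg (by linarith) _),
            ← Real.rpow_mul (by linarith)]
          congr 2; ring
  calc 2 * C * (R : ℝ) ^ (2 * s) * quadForm J g
      ≤ 2 * C * (4 ^ (2 * s) * v ^ (2 * s / d)) * quadForm J g := by gcongr
    _ = _ := by ring

theorem norm_translation_sub_le_sum {ι : Type*} (g : L2 d) (t : Finset ι) (x : ι → Fin d → ℤ) :
    ‖translation (∑ i ∈ t, x i) g - g‖ ≤ ∑ i ∈ t, ‖translation (x i) g - g‖ :=
  Finset.le_sum_of_subadditive (fun m => ‖translation m g - g‖) (by simp) (fun m k => by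
    have h : translation (m + k) g - g =
        translation m (translation k g - g) + (translation m g - g) := by
      rw [translation_add, map_sub]; abel
    rw [h, add_comm ‖translation m g - g‖]
    refine (norm_add_le _ _).trans ?_
    rw [(translation m).norm_map]) t x

theorem norm_translation_neg_sub (g : L2 d) (m : Fin d → ℤ) :
    ‖translation (-m) g - g‖ = ‖translation m g - g‖ := by
  rw [← (translation m).norm_map, map_sub, ← translation_add, add_neg_cancel, translation_zero,
    norm_sub_rev]

theorem norm_translation_zsmul_sub_le (g : L2 d) (m : Fin d → ℤ) (k : ℤ) :
    ‖translation (k • m) g - g‖ ≤ k.natAbs * ‖translation m g - g‖ := by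
  have h : ∀ k : ℕ, ‖translation (k • m) g - g‖ ≤ k * ‖translation m g - g‖ := fun k => by
    simpa using norm_translation_sub_le_sum g (Finset.range k) fun _ => m
  rcases Int.natAbs_eq k with hk | hk
  · conv_lhs => rw [hk]
    rw [natCast_zsmul]
    exact h _
  · conv_lhs => rw [hk]
    rw [neg_smul, natCast_zsmul, norm_translation_neg_sub]
    exact h _

theorem norm_translation_sub_le {g : L2 d} {B : ℝ}
    (hB : ∀ i, ‖translation (Pi.single i 1) g - g‖ ≤ B) (h : Fin d → ℤ) :
    ‖translation h g - g‖ ≤ latticeNorm h * B := by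
  have h1 : h = ∑ i, h i • (Pi.single i (1 : ℤ) : Fin d → ℤ) := by
    ext j
    simp [Finset.sum_apply, Pi.single_apply]
  conv_lhs => rw [h1]
  refine (norm_translation_sub_le_sum g _ _).trans ?_
  rw [latticeNorm, Nat.cast_sum, Finset.sum_mul]
  refine Finset.sum_le_sum fun i _ => (norm_translation_zsmul_sub_le g _ _).trans ?_
  exact mul_le_mul_of_nonneg_left (hB i) (Nat.cast_nonneg _)

/-- Nearest-neighbour coupling alone suffices: a displacement in the box is a path of at most `dR`
unit steps, each costing at most `√(2Q/J₁)`, where `Q` is the quadratic form at `g`. Squaring and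
summing over `R^d` displacements gives `R^(d+2)`. -/
theorem exists_box_bound_nearest (hd : 1 ≤ d)
    (hs : Summable (fun m : Fin d → ℤ => J (latticeNorm m)))
    (hJ : ∀ k, 0 ≤ J k) (hJ1 : 0 < J 1) :
    ∃ C : ℝ, 0 < C ∧ ∃ K : ℕ, ∀ R : ℕ, 1 ≤ R → ∀ g : L2 d,
      ∑ h ∈ box d K R, ‖translation h g - g‖ ^ 2 ≤
        C * ((R : ℝ) ^ d * (R : ℝ) ^ (2 * (1 : ℝ))) * quadForm J g := by
  have hd0 : (0 : ℝ) < d := by exact_mod_cast hd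
  refine ⟨d ^ 2 * (2 / J 1), by positivity, 0, fun R hR g => ?_⟩
  have hQ := quadForm_nonneg hs hJ g
  have h1 : ∀ i, ‖translation (Pi.single i 1) g - g‖ ≤ √(2 * quadForm J g / J 1) := by
    intro i
    have h := mul_norm_translation_sub_sq_le hs hJ g {Pi.single i 1}
    rw [Finset.sum_singleton, latticeNorm_single] at h
    refine Real.le_sqrt_of_sq_le ?_
    rw [le_div_iff₀ hJ1]
    linarith
  have h2 : ∀ h ∈ box d 0 R, ‖translation h g - g‖ ^ 2 ≤
      (d * R : ℝ) ^ 2 * (2 * quadForm J g / J 1) := by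
    intro h hh
    have h3 := norm_translation_sub_le h1 h
    have h4 : (latticeNorm h : ℝ) ≤ d * R := by
      have := (latticeNorm_mem_box hd hR hh).2
      rw [zero_add, mul_one] at this
      exact_mod_cast this
    have h5 : ‖translation h g - g‖ ≤ d * R * √(2 * quadForm J g / J 1) :=
      h3.trans (mul_le_mul_of_nonneg_right h4 (Real.sqrt_nonneg _))
    calc ‖translation h g - g‖ ^ 2 ≤ (d * R * √(2 * quadForm J g / J 1)) ^ 2 :=
          pow_le_pow_left₀ (norm_nonneg _) h5 2
      _ = _ := by rw [mul_pow, Real.sq_sqrt (by positivity)]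
  refine (Finset.sum_le_card_nsmul _ _ _ h2).trans_eq ?_
  rw [card_box, nsmul_eq_mul, mul_one, Real.rpow_two, Nat.cast_pow]
  ring

/-- Here long jumps are used directly. The box starts at `K` so that every displacement lies where
`k^(d+a) J_k > A/2`; with lengths at most `d(K+1)R`, each weight `J_{|h|}` is at least a multiple of
`R^(-d-a)`. -/
theorem exists_box_bound_fractional (hd : 1 ≤ d)
    (hs : Summable (fun m : Fin d → ℤ => J (latticeNorm m)))
    (hJ : ∀ k, 0 ≤ J k) {a A : ℝ} (ha : 0 < a) (hA : 0 < A)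
    (hlim : Tendsto (fun k : ℕ => (k : ℝ) ^ ((d : ℝ) + a) * J k) atTop (𝓝 A)) :
    ∃ C : ℝ, 0 < C ∧ ∃ K : ℕ, ∀ R : ℕ, 1 ≤ R → ∀ g : L2 d,
      ∑ h ∈ box d K R, ‖translation h g - g‖ ^ 2 ≤
        C * ((R : ℝ) ^ d * (R : ℝ) ^ (2 * (a / 2))) * quadForm J g := by
  have hd0 : (0 : ℝ) < d := by exact_mod_cast hd
  obtain ⟨K, hK⟩ := eventually_atTop.1 (hlim.eventually_const_lt (half_lt_self hA))
  set M : ℝ := (d : ℝ) * (K + 1) with hM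
  have hM0 : 0 < M := by positivity
  refine ⟨M ^ ((d : ℝ) + a) / (A / 2) * 2, by positivity, K, fun R hR g => ?_⟩
  have hR0 : (0 : ℝ) < R := by exact_mod_cast hR
  have h1 : ∀ h ∈ box d K R, 1 ≤ (M * R) ^ ((d : ℝ) + a) / (A / 2) * J (latticeNorm h) := by
    intro h hh
    obtain ⟨h2, h3⟩ := latticeNorm_mem_box hd hR hh
    have h4 : (latticeNorm h : ℝ) ≤ M * R := by
      rw [hM]; exact_mod_cast h3
    have h5 : (latticeNorm h : ℝ) ^ ((d : ℝ) + a) ≤ (M * R) ^ ((d : ℝ) + a) :=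
      Real.rpow_le_rpow (Nat.cast_nonneg _) h4 (by positivity)
    have h6 := mul_le_mul_of_nonneg_right h5 (hJ (latticeNorm h))
    rw [div_mul_eq_mul_div, one_le_div (by positivity)]
    exact (hK _ h2).le.trans h6
  have hRR : (M * R) ^ ((d : ℝ) + a) = M ^ ((d : ℝ) + a) * ((R : ℝ) ^ d * (R : ℝ) ^ a) := by
    rw [Real.mul_rpow hM0.le hR0.le, Real.rpow_add hR0, Real.rpow_natCast]
  calc ∑ h ∈ box d K R, ‖translation h g - g‖ ^ 2
      ≤ ∑ h ∈ box d K R, (M * R) ^ ((d : ℝ) + a) / (A / 2) *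
          (J (latticeNorm h) * ‖translation h g - g‖ ^ 2) := by
        refine Finset.sum_le_sum fun h hh => ?_
        have := mul_le_mul_of_nonneg_right (h1 h hh) (sq_nonneg ‖translation h g - g‖)
        linarith
    _ = (M * R) ^ ((d : ℝ) + a) / (A / 2) *
          ∑ h ∈ box d K R, J (latticeNorm h) * ‖translation h g - g‖ ^ 2 := by
        rw [Finset.mul_sum]
    _ ≤ (M * R) ^ ((d : ℝ) + a) / (A / 2) * (2 * quadForm J g) :=
        mul_le_mul_of_nonneg_left (mul_norm_translation_sub_sq_le hs hJ g _) (by positivity)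
    _ = _ := by
        rw [hRR, mul_div_cancel₀ a two_ne_zero]
        ring

theorem alphaPrime_pos {α : ℝ≥0∞} (hα : 0 < α) : 0 < alphaPrime α := by
  rw [alphaPrime]
  split_ifs with h
  · exact half_pos (ENNReal.toReal_pos hα.ne' (h.trans_le le_top).ne)
  · exact one_pos

theorem exists_box_bound (hd : 1 ≤ d)
    (hs : Summable (fun m : Fin d → ℤ => J (latticeNorm m)))
    (hJ : ∀ k, 0 ≤ J k) (hJ1 : 0 < J 1) {α : ℝ≥0∞} (hα : IsOfOrder d J α) :
    ∃ C : ℝ, 0 < C ∧ ∃ K : ℕ, ∀ R : ℕ, 1 ≤ R → ∀ g : L2 d,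
      ∑ h ∈ box d K R, ‖translation h g - g‖ ^ 2 ≤
        C * ((R : ℝ) ^ d * (R : ℝ) ^ (2 * alphaPrime α)) * quadForm J g := by
  by_cases h : α < 2
  · have htop : α ≠ ⊤ := (h.trans_le le_top).ne
    obtain ⟨A, hA, hlim⟩ := hα.2.1 htop
    rw [alphaPrime, if_pos h]
    exact exists_box_bound_fractional hd hs hJ (ENNReal.toReal_pos hα.1.ne' htop) hA hlim
  · rw [alphaPrime, if_neg h]
    exact exists_box_bound_nearest hd hs hJ hJ1

end FaberKrahn

/-! ### Dyadic layers and the Gagliardo–Nirenberg inequality -/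

section Layers

theorem sum_sq_le_sq_sum_of_nonneg {ι : Type*} (s : Finset ι) {f : ι → ℝ}
    (hf : ∀ i ∈ s, 0 ≤ f i) : ∑ i ∈ s, f i ^ 2 ≤ (∑ i ∈ s, f i) ^ 2 := by
  rw [sq, Finset.sum_mul]
  refine Finset.sum_le_sum fun i hi => ?_
  rw [sq]
  exact mul_le_mul_of_nonneg_left (Finset.single_le_sum hf hi) (hf i hi)

theorem min_sub_min_le {a b x y : ℝ} (hab : a ≤ b) (hyx : y ≤ x) :
    min y b - min y a ≤ min x b - min x a := by
  grind

/-- Layer heights are monotone in the value, so for `y ≤ x` the increments are nonnegative and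
telescope to at most `x - y`; for nonnegative numbers the sum of squares is at most the square of
the sum. -/
theorem sum_layer_sub_sq_le {t : ℕ → ℝ} (ht : Antitone t) (N : ℕ) (x y : ℝ) :
    ∑ k ∈ Finset.range N, ((min x (t k) - min x (t (k + 1))) -
      (min y (t k) - min y (t (k + 1)))) ^ 2 ≤ (x - y) ^ 2 := by
  wlog hyx : y ≤ x generalizing x y
  · have := this y x (le_of_not_ge hyx)
    rw [← neg_sub, neg_sq]
    refine le_trans (Finset.sum_le_sum fun k _ => le_of_eq ?_) this
    ring
  have h0 : ∀ k ∈ Finset.range N, 0 ≤ (min x (t k) - min x (t (k + 1))) -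
      (min y (t k) - min y (t (k + 1))) := fun k _ =>
    sub_nonneg.2 (min_sub_min_le (ht k.le_succ) hyx)
  refine (sum_sq_le_sq_sum_of_nonneg _ h0).trans ?_
  refine pow_le_pow_left₀ (Finset.sum_nonneg h0) ?_ 2
  rw [Finset.sum_sub_distrib, Finset.sum_range_sub' (fun k => min x (t k)),
    Finset.sum_range_sub' (fun k => min y (t k))]
  have h1 : min y (t N) ≤ min x (t N) := min_le_min_right _ hyx
  have h2 : min x (t 0) - min y (t 0) ≤ x - y := by grind
  linarith

theorem min_sub_min_nonneg_le {a b x : ℝ} (ha : 0 ≤ a) (hab : a ≤ b) (hx : 0 ≤ x) :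
    0 ≤ min x b - min x a ∧ min x b - min x a ≤ x := by
  grind

/-- The part of the modulus of `q` between the heights `a` and `b`. -/
noncomputable def layer (q : L2 d) {a b : ℝ} (ha : 0 ≤ a) (hab : a ≤ b) : L2 d :=
  ⟨fun n => ((min ‖q n‖ b - min ‖q n‖ a : ℝ) : ℂ), memℓp_two_of_summable <| by
    refine Summable.of_nonneg_of_le (fun _ => by positivity) (fun n => ?_)
      (hasSum_norm_sq q).summable
    obtain ⟨h1, h2⟩ := min_sub_min_nonneg_le ha hab (norm_nonneg (q n))
    rw [Complex.norm_real, Real.norm_of_nonneg h1]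
    exact pow_le_pow_left₀ h1 h2 2⟩

theorem layer_apply (q : L2 d) {a b : ℝ} (ha : 0 ≤ a) (hab : a ≤ b) (n : Fin d → ℤ) :
    layer q ha hab n = ((min ‖q n‖ b - min ‖q n‖ a : ℝ) : ℂ) := rfl

theorem sum_quadForm_layer_le (hs : Summable (fun m : Fin d → ℤ => J (latticeNorm m)))
    (hJ : ∀ k, 0 ≤ J k) (q : L2 d) {t : ℕ → ℝ} (ht0 : ∀ k, 0 ≤ t k) (ht : Antitone t) (N : ℕ) :
    ∑ k ∈ Finset.range N, quadForm J (layer q (ht0 (k + 1)) (ht k.le_succ)) ≤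
      quadForm J q := by
  refine hasSum_le (fun m => ?_) (hasSum_sum fun k _ => hasSum_quadForm hs hJ _)
    (hasSum_quadForm hs hJ q)
  rw [← Finset.mul_sum, ← Finset.sum_div]
  refine mul_le_mul_of_nonneg_left (div_le_div_of_nonneg_right ?_ zero_le_two) (hJ _)
  refine hasSum_le (fun n => ?_) (hasSum_sum fun k _ => hasSum_norm_sq _) (hasSum_norm_sq _)
  have h1 : (‖q (n + m)‖ - ‖q n‖) ^ 2 ≤ ‖(translation m q - q : L2 d) n‖ ^ 2 := by
    rw [← sq_abs]
    exact pow_le_pow_left₀ (abs_nonneg _) (abs_norm_sub_norm_le _ _) 2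
  refine le_trans (le_of_eq (Finset.sum_congr rfl fun k _ => ?_))
    ((sum_layer_sub_sq_le ht N ‖q (n + m)‖ ‖q n‖).trans h1)
  rw [lp.coeFn_sub, Pi.sub_apply, translation_apply, layer_apply, layer_apply,
    ← Complex.ofReal_sub, Complex.norm_real, Real.norm_eq_abs, sq_abs]

theorem finite_lt_norm (q : L2 d) {τ : ℝ} (hτ : 0 < τ) : {n | τ < ‖q n‖}.Finite := by
  have h := (hasSum_norm_sq q).summable.tendsto_cofinite_zero.eventually_lt_const
    (show 0 < τ ^ 2 by positivity)
  refine Set.Finite.subset h fun n hn hlt => ?_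
  exact (lt_of_pow_lt_pow_left₀ 2 hτ.le hlt).not_gt hn

theorem card_lt_norm_mul_le (q : L2 d) {τ : ℝ} (hτ : 0 < τ) :
    ((finite_lt_norm q hτ).toFinset.card : ℝ) * τ ^ 2 ≤ ‖q‖ ^ 2 := by
  rw [← nsmul_eq_mul]
  refine le_trans (Finset.card_nsmul_le_sum _ (fun n => ‖q n‖ ^ 2) _ fun n hn => ?_)
    (sum_le_hasSum _ (fun _ _ => by positivity) (hasSum_norm_sq q))
  rw [Set.Finite.mem_toFinset] at hn
  exact pow_le_pow_left₀ hτ.le (le_of_lt hn) 2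

theorem exists_dyadic {A x : ℝ} (hx : 0 < x) (hxA : x ≤ A) :
    ∃ k : ℕ, A / 2 ^ (k + 1) < x ∧ x ≤ A / 2 ^ k := by
  obtain ⟨k, hk1, hk2⟩ := exists_nat_pow_near ((one_le_div hx).2 hxA) one_lt_two
  refine ⟨k, ?_, ?_⟩
  · rw [div_lt_iff₀ (by positivity)]
    rwa [div_lt_iff₀ hx, mul_comm] at hk2
  · rw [le_div_iff₀ (by positivity)]
    rwa [le_div_iff₀ hx, mul_comm] at hk1

/-- Maz'ya-style truncation at heights `‖q‖ / 2^(k+1)`. The exponent `σ/2` is exactly the one for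
which the dyadic factors from height and support size cancel, so the layer estimates are uniform in
`k` and sum by `sum_quadForm_layer_le`. -/
theorem powerSum_le_of_faberKrahn (hs : Summable (fun m : Fin d → ℤ => J (latticeNorm m)))
    (hJ : ∀ k, 0 ≤ J k) {σ C : ℝ} (hσ : 0 < σ) (hC : 0 < C)
    (hFK : ∀ v : ℝ, 1 ≤ v → ∀ S : Finset (Fin d → ℤ), (S.card : ℝ) ≤ v → ∀ g : L2 d,
      (∀ n ∉ S, g n = 0) → ‖g‖ ^ 2 ≤ C * v ^ (σ / 2) * quadForm J g) (q : L2 d) :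
    powerSum (1 + σ) q ≤ 16 * C * 4 ^ σ * ‖q‖ ^ σ * quadForm J q := by
  have hQ := quadForm_nonneg hs hJ q
  rcases (norm_nonneg q).eq_or_lt with hq | hA
  · have : q = 0 := norm_eq_zero.1 hq.symm
    subst this
    have h0 : powerSum (1 + σ) (0 : L2 d) = 0 := by
      simp [powerSum, Real.zero_rpow (by linarith : 1 + σ + 1 ≠ 0)]
    rw [h0]
    positivity
  set A := ‖q‖ with hA_def
  set t : ℕ → ℝ := fun k => A / 2 ^ (k + 1) with ht_def
  have htpos : ∀ k, 0 < t k := fun k => by positivity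
  have ht0 : ∀ k, 0 ≤ t k := fun k => (htpos k).le
  have htanti : Antitone t := by
    refine antitone_nat_of_succ_le fun k => ?_
    simp only [ht_def]
    gcongr
    · norm_num
    · omega
  have ht2 : ∀ k, t (k + 1) = t k / 2 := fun k => by
    simp only [ht_def, pow_succ]
    field_simp
  set g : ℕ → L2 d := fun k => layer q (ht0 (k + 1)) (htanti k.le_succ) with hg_def
  have hlayer : ∀ k, (A / 2 ^ k) ^ σ * ‖g k‖ ^ 2 ≤ C * (4 * A) ^ σ * quadForm J (g k) := by
    intro k
    -- Chebyshev's inequality at the layer's lower height `A / 2^(k+2)`.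
    have hcard : ((finite_lt_norm q (htpos (k + 1))).toFinset.card : ℝ) ≤ (2 ^ (k + 2)) ^ 2 := by
      have h1 := card_lt_norm_mul_le q (htpos (k + 1))
      have h2 : A ^ 2 = (2 ^ (k + 2)) ^ 2 * t (k + 1) ^ 2 := by
        simp only [ht_def]
        field_simp
      rw [← hA_def, h2] at h1
      exact le_of_mul_le_mul_right h1 (pow_pos (htpos _) 2)
    have h1 := hFK _ (one_le_pow₀ (one_le_pow₀ one_le_two)) _ hcard (g k) fun n hn => by
      have hn' : ‖q n‖ ≤ t (k + 1) := by simpa using hn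
      rw [hg_def, layer_apply, min_eq_left hn', min_eq_left (hn'.trans (htanti k.le_succ))]
      simp
    have h2 : (((2 : ℝ) ^ (k + 2)) ^ 2) ^ (σ / 2) = (2 ^ (k + 2)) ^ σ := by
      rw [← Real.rpow_two, ← Real.rpow_mul (by positivity)]
      congr 1; ring
    rw [h2] at h1
    have h3 : (A / 2 ^ k) ^ σ * (2 ^ (k + 2)) ^ σ = (4 * A) ^ σ := by
      rw [← Real.mul_rpow (by positivity) (by positivity)]
      congr 1
      rw [pow_add]
      field_simp
      norm_num
    calc (A / 2 ^ k) ^ σ * ‖g k‖ ^ 2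
        ≤ (A / 2 ^ k) ^ σ * (C * (2 ^ (k + 2)) ^ σ * quadForm J (g k)) := by gcongr
      _ = C * ((A / 2 ^ k) ^ σ * (2 ^ (k + 2)) ^ σ) * quadForm J (g k) := by ring
      _ = _ := by rw [h3]
  -- Choose `k` with `t k < ‖q n‖ ≤ 2 t k`. Layer `k` is then full, of height `t k / 2`, and `(2 t
  -- k)² = 16 (t k / 2)²` gives the constant.
  have hpt : ∀ n, ∃ k, ‖q n‖ ^ (1 + σ + 1) ≤ 16 * (A / 2 ^ k) ^ σ * ‖g k n‖ ^ 2 := by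
    intro n
    rcases (norm_nonneg (q n)).eq_or_lt with hn | hn
    · refine ⟨0, ?_⟩
      rw [← hn, Real.zero_rpow (by linarith)]
      positivity
    · obtain ⟨k, hk1, hk2⟩ := exists_dyadic hn (norm_apply_le q n)
      refine ⟨k, ?_⟩
      have hk1' : t k < ‖q n‖ := hk1
      have hk2' : ‖q n‖ ≤ 2 * t k := hk2.trans_eq (by
        simp only [ht_def, pow_succ, hA_def]; field_simp)
      have hgk : ‖g k n‖ = t k / 2 := by
        rw [hg_def, layer_apply, min_eq_right hk1'.le,
          min_eq_right ((htanti k.le_succ).trans hk1'.le), ht2, sub_half,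
          Complex.norm_real, Real.norm_of_nonneg (half_pos (htpos k)).le]
      have h1 : 1 + σ + 1 = σ + 2 := by ring
      rw [h1, Real.rpow_add hn, Real.rpow_two, hgk]
      have h2 : ‖q n‖ ^ σ ≤ (A / 2 ^ k) ^ σ := Real.rpow_le_rpow hn.le hk2 hσ.le
      have h3 : ‖q n‖ ^ 2 ≤ 16 * (t k / 2) ^ 2 := by nlinarith
      calc ‖q n‖ ^ σ * ‖q n‖ ^ 2 ≤ (A / 2 ^ k) ^ σ * (16 * (t k / 2) ^ 2) := by gcongr
        _ = _ := by ring
  choose κ hκ using hpt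
  refine (summable_powerSum (by linarith) q).tsum_le_of_sum_le fun F => ?_
  -- Only finitely many layers serve the finite set `F`.
  set N := F.sup κ + 1 with hN
  have hκN : ∀ n ∈ F, κ n ∈ Finset.range N := fun n hn =>
    Finset.mem_range.2 (Nat.lt_succ_of_le (Finset.le_sup (f := κ) hn))
  calc ∑ n ∈ F, ‖q n‖ ^ (1 + σ + 1)
      ≤ ∑ n ∈ F, ∑ k ∈ Finset.range N, 16 * (A / 2 ^ k) ^ σ * ‖g k n‖ ^ 2 :=
        Finset.sum_le_sum fun n hn => (hκ n).trans
          (Finset.single_le_sum (f := fun k => 16 * (A / 2 ^ k) ^ σ * ‖g k n‖ ^ 2)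
            (fun k _ => by positivity) (hκN n hn))
    _ = ∑ k ∈ Finset.range N, 16 * (A / 2 ^ k) ^ σ * ∑ n ∈ F, ‖g k n‖ ^ 2 := by
        rw [Finset.sum_comm]
        exact Finset.sum_congr rfl fun k _ => (Finset.mul_sum _ _ _).symm
    _ ≤ ∑ k ∈ Finset.range N, 16 * (A / 2 ^ k) ^ σ * ‖g k‖ ^ 2 := by
        refine Finset.sum_le_sum fun k _ => ?_
        have := sum_le_hasSum F (fun _ _ => by positivity) (hasSum_norm_sq (g k))
        gcongr
    _ ≤ ∑ k ∈ Finset.range N, 16 * (C * (4 * A) ^ σ) * quadForm J (g k) := by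
        refine Finset.sum_le_sum fun k _ => ?_
        have := hlayer k
        linarith
    _ = 16 * (C * (4 * A) ^ σ) * ∑ k ∈ Finset.range N, quadForm J (g k) := by
        rw [Finset.mul_sum]
    _ ≤ 16 * (C * (4 * A) ^ σ) * quadForm J q := by
        have := sum_quadForm_layer_le hs hJ q ht0 htanti N
        gcongr
    _ = _ := by
        rw [Real.mul_rpow (by norm_num) hA.le]
        ring

theorem powerSum_le_mul_powerSum {r : ℝ} (hr : 1 < r) (hrp : r ≤ p) (q : L2 d) :
    powerSum p q ≤ ‖q‖ ^ (p - r) * powerSum r q := by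
  refine hasSum_le (fun n => ?_) (summable_powerSum (hr.trans_le hrp) q).hasSum
    ((summable_powerSum hr q).hasSum.mul_left _)
  have h : p + 1 = (p - r) + (r + 1) := by ring
  rw [h, Real.rpow_add_of_nonneg (norm_nonneg _) (by linarith) (by linarith)]
  have := Real.rpow_le_rpow (norm_nonneg _) (norm_apply_le q n) (by linarith : 0 ≤ p - r)
  gcongr

theorem exists_gagliardoNirenberg (hd : 1 ≤ d)
    (hs : Summable (fun m : Fin d → ℤ => J (latticeNorm m)))
    (hJ : ∀ k, 0 ≤ J k) (hJ1 : 0 < J 1) {α : ℝ≥0∞} (hα : IsOfOrder d J α)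
    (hp : 1 + 4 * alphaPrime α / (d : ℝ) ≤ p) :
    ∃ C : ℝ, 0 < C ∧ ∀ q : L2 d, powerSum p q ≤ C * ‖q‖ ^ (p - 1) * quadForm J q := by
  have hd0 : (0 : ℝ) < d := by exact_mod_cast hd
  have hs0 := alphaPrime_pos hα.1
  obtain ⟨C, hC, K, hbox⟩ := exists_box_bound hd hs hJ hJ1 hα
  set σ := 4 * alphaPrime α / (d : ℝ) with hσ_def
  have hσ : 0 < σ := by positivity
  have hσ2 : 2 * alphaPrime α / d = σ / 2 := by rw [hσ_def]; ring
  have hmain := powerSum_le_of_faberKrahn hs hJ hσ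
    (show 0 < 2 * C * 4 ^ (2 * alphaPrime α) by positivity)
    fun v hv S hS g hg => hσ2 ▸ norm_sq_le_of_box_bound hd hs hJ hs0 hC hbox hv hS hg
  refine ⟨_, show 0 < 16 * (2 * C * 4 ^ (2 * alphaPrime α)) * 4 ^ σ by positivity, fun q => ?_⟩
  refine (powerSum_le_mul_powerSum (by linarith) hp q).trans ?_
  have h := mul_le_mul_of_nonneg_left (hmain q)
    (Real.rpow_nonneg (norm_nonneg q) (p - (1 + σ)))
  refine h.trans_eq ?_
  have h1 : p - 1 = (p - (1 + σ)) + σ := by ring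
  rw [h1, Real.rpow_add_of_nonneg (norm_nonneg _) (by linarith) hσ.le]
  ring

end Layers

/-! ### Positivity of the threshold -/

theorem excitationThreshold_pos (hd : 1 ≤ d)
    (hs : Summable (fun m : Fin d → ℤ => J (latticeNorm m)))
    (hJ : ∀ k, 0 ≤ J k) (hJ1 : 0 < J 1) {α : ℝ≥0∞} (hα : IsOfOrder d J α) (hp1 : 1 < p)
    (hp : 1 + 4 * alphaPrime α / (d : ℝ) ≤ p) : 0 < excitationThreshold d J p := by
  obtain ⟨C, hC, hGN⟩ := exists_gagliardoNirenberg hd hs hJ hJ1 hα hp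
  have hb : 0 < (p + 1) / 2 / C := div_pos (by linarith) hC
  -- The mass at which the prefactor `(p+1)/2 * ν^(-(p-1)/2)` equals `C`.
  set ν := ((p + 1) / 2 / C) ^ (2 / (p - 1)) with hν_def
  have hν : 0 < ν := Real.rpow_pos_of_pos hb _
  have h1 : ν ^ (-((p - 1) / 2)) = ((p + 1) / 2 / C)⁻¹ := by
    rw [hν_def, ← Real.rpow_mul hb.le, ← Real.rpow_neg_one]
    congr 1
    have : p - 1 ≠ 0 := by linarith
    field_simp
  refine hν.trans_le (le_csSup (bddAbove_gnInequality hp1) ⟨hν, fun q => ?_⟩)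
  rw [h1, inv_div, mul_div_cancel₀ _ (by linarith : (p + 1) / 2 ≠ 0)]
  exact hGN q

end NonlocalLattice

theorem propositionp1 (d : ℕ) (hd : 1 ≤ d) (J : ℕ → ℝ) (hJ_nonneg : ∀ k, 0 ≤ J k)
    (hJ_zero : J 0 = 0) (hJ_one : 0 < J 1)
    (hJ_summable : Summable (fun m : Fin d → ℤ => J (NonlocalLattice.latticeNorm m)))
    (α : ENNReal) (hJ_order : NonlocalLattice.IsOfOrder d J α) (p : ℝ) (hp : 1 < p) :
    (1 + 4 * NonlocalLattice.alphaPrime α / (d : ℝ) ≤ p →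
      0 < NonlocalLattice.excitationThreshold d J p) ∧
    (∀ ν : ℝ, 0 < ν → NonlocalLattice.excitationThreshold d J p < ν →
      NonlocalLattice.minEnergy d J p ν < 0 ∧
        ∃ q : NonlocalLattice.L2 d, NonlocalLattice.IsGroundState J p ν q) ∧
    (∀ ν : ℝ, 0 < ν → ν < NonlocalLattice.excitationThreshold d J p →
      NonlocalLattice.minEnergy d J p ν = 0 ∧
        ¬ ∃ q : NonlocalLattice.L2 d, NonlocalLattice.IsGroundState J p ν q) := by
  exact ⟨NonlocalLattice.excitationThreshold_pos hd hJ_summable hJ_nonneg hJ_one hJ_order hp,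
    fun _ hν h =>
      NonlocalLattice.groundState_of_excitationThreshold_lt hJ_summable hJ_nonneg hp hν h,
    fun _ hν h => NonlocalLattice.no_groundState_of_lt_excitationThreshold hd hJ_summable
      hJ_nonneg hJ_one hp hν h⟩
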